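/- Theorem 1.8. Let $\mathcal M$ be a regular matroid with finite ground set $E$, represented by a totally unimodular real matrix $M$ with columns indexed by $E$. Terminology. A signed circuit (resp. signed cocircuit) is a $\{0,\pm1\}$-vector in $\ker M$ (resp. in $\operatorname{im} M^T$) whose support is a circuit (resp. cocircuit) of $\mathcal M$. Each edge $e\in E$ has two opposite arcs $\pm\vec e$; signed circuits and cocircuits are viewed as sets of arcs. A fourientation $F$ is a set of arcs, $-F$ is the set of its reversed arcs and $F^c$ its complement. An edge is bioriented in $F$ if both its arcs are in $F$, and one-way oriented if exactly one is; an orientation is a fourientation in which every edge is one-way oriented. A potential circuit of $F$ is a signed circuit contained in $F$; a potential cocircuit of $F$ is a signed cocircuit contained in $-(F^c)$. A circuit (resp. cocircuit) reversal replaces in an orientation $O$ a signed circuit (resp. cocircuit) contained in $O$ by its opposite; circuit reversal classes, cocircuit reversal classes and circuit-cocircuit reversal classes $[O]$ are the classes of the equivalence relations on orientations generated by circuit reversals, by cocircuit reversals, and by both. An external atlas $\mathcal A$ assigns to each basis $B$ a fourientation $\vec B$ in which the edges in $B$ are bioriented and those not in $B$ are one-way oriented; an internal atlas $\mathcal A^*$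 assigns to each basis $B$ a fourientation $\vec{B^*}$ in which the edges not in $B$ are bioriented and those in $B$ are one-way oriented. Put $f_{\mathcal A,\mathcal A^*}(B)=\vec B\cap\vec{B^*}$, an orientation. The atlas $\mathcal A$ is dissecting (resp. triangulating) if for any two distinct bases $B_1,B_2$ the fourientation $\vec{B_1}\cap(-\vec{B_2})$ has a potential cocircuit (resp. has no potential circuit). The atlas $\mathcal A^*$ is dissecting (resp. triangulating) if for any two distinct bases $B_1,B_2$ the fourientation $(\vec{B_1^*}\cap(-\vec{B_2^*}))^c$ has a potential circuit (resp. has no potential cocircuit). Theorem. Let $\mathcal A$ and $\mathcal A^*$ both be dissecting, and suppose that at least one of them is triangulating. Then for every orientation $O$ there is a unique basis $B$ with $f_{\mathcal A,\mathcal A^*}(B)\in[O]$. The orientation $O$ can be obtained from $f_{\mathcal A,\mathcal A^*}(B)$ by reversing signed circuits $\{\vec{C_i}\}_{i\in I}$ and signed cocircuits $\{\vec{C_j^*}\}_{j\in J}$ contained in $f_{\mathcal A,\mathcal A^*}(B)$ whose supports $C_i$, $C_j^*$ are all pairwise disjoint, and the set $$\varphi_{\mathcal A,\mathcal A^*}(O)=\Big(B\cup\biguplus_{i\in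 I}C_i\Big)\setminus\biguplus_{j\in J}C_j^*$$ does not depend on the choice of these signed circuits and cocircuits. Moreover: (1) $\varphi_{\mathcal A,\mathcal A^*}$ is a bijection from the orientations of $\mathcal M$ to the subsets of $E$. It is in fact tiling: for any two distinct orientations $O_1,O_2$ there is an edge $e$ on which $O_1$ and $O_2$ differ and which lies in the symmetric difference $\varphi_{\mathcal A,\mathcal A^*}(O_1)\bigtriangleup\varphi_{\mathcal A,\mathcal A^*}(O_2)$. (2) The image under $\varphi_{\mathcal A,\mathcal A^*}^{-1}$ of the set of independent sets of $\mathcal M$ contains exactly one orientation from each circuit reversal class. (3) The image under $\varphi_{\mathcal A,\mathcal A^*}^{-1}$ of the set of spanning sets of $\mathcal M$ contains exactly one orientation from each cocircuit reversal class. -/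

import Mathlib

open scoped Matrix

namespace RegularMatroid

/-- The real matrix `M` represents the matroid `N` on the ground set `E` (all of the type `E`):
a set of edges is independent iff the corresponding family of columns is linearly independent. -/
def Represents {E m : Type*} (M : Matrix m E ℝ) (N : Matroid E) : Prop :=
  N.E = Set.univ ∧ ∀ I : Set E, N.Indep I ↔ LinearIndepOn ℝ M.col I

/-- All entries are `0`, `1` or `-1`. -/
def IsSignVector {E : Type*} (v : E → ℝ) : Prop :=
  ∀ e, v e = 0 ∨ v e = 1 ∨ v e = -1

/-- A signed circuit: a `{0, ±1}`-vector in `ker M` whose support is a circuit. -/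
def IsSignedCircuit {E m : Type*} [Fintype E] (M : Matrix m E ℝ) (N : Matroid E)
    (v : E → ℝ) : Prop :=
  IsSignVector v ∧ M *ᵥ v = 0 ∧ N.IsCircuit (Function.support v)

/-- A signed cocircuit: a `{0, ±1}`-vector in `im Mᵀ` whose support is a cocircuit. -/
def IsSignedCocircuit {E m : Type*} [Fintype m] (M : Matrix m E ℝ) (N : Matroid E)
    (v : E → ℝ) : Prop :=
  IsSignVector v ∧ (∃ u : m → ℝ, Mᵀ *ᵥ u = v) ∧ N.IsCocircuit (Function.support v)

/-- An arc: an edge together with a sign; `(e, s)` stands for the vector with `e`-th entry `s`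
and all other entries zero. -/
abbrev Arc (E : Type*) : Type _ := E × ℤˣ

/-- A fourientation is an arbitrary set of arcs. -/
abbrev Fourientation (E : Type*) : Type _ := Set (Arc E)

/-- The set of arcs of a `{0, ±1}`-vector. -/
def arcs {E : Type*} (v : E → ℝ) : Fourientation E :=
  {a | v a.1 = ((a.2 : ℤ) : ℝ)}

/-- The fourientation `-F`, with all arcs reversed. -/
def rev {E : Type*} (F : Fourientation E) : Fourientation E :=
  {a | (a.1, -a.2) ∈ F}

/-- The restriction of `F` to a single edge `e`. -/
def restrict {E : Type*} (F : Fourientation E) (e : E) : Fourientation E :=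
  {a | a ∈ F ∧ a.1 = e}

/-- Exactly one of the two arcs of `e` is in `F`. -/
def OneWay {E : Type*} (F : Fourientation E) (e : E) : Prop :=
  ∃! s : ℤˣ, (e, s) ∈ F

/-- Both arcs of `e` are in `F`. -/
def Bioriented {E : Type*} (F : Fourientation E) (e : E) : Prop :=
  ∀ s : ℤˣ, (e, s) ∈ F

/-- An orientation: a set of arcs in which each edge appears exactly once. -/
def Orientation (E : Type*) : Type _ :=
  {O : Fourientation E // ∀ e, OneWay O e}

/-- `v` is a potential circuit of `F`: a signed circuit contained in `F`. -/
def IsPotentialCircuit {E m : Type*} [Fintype E] (M : Matrix m E ℝ) (N : Matroid E)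
    (F : Fourientation E) (v : E → ℝ) : Prop :=
  IsSignedCircuit M N v ∧ arcs v ⊆ F

/-- `v` is a potential cocircuit of `F`: a signed cocircuit contained in `-Fᶜ`. -/
def IsPotentialCocircuit {E m : Type*} [Fintype m] (M : Matrix m E ℝ) (N : Matroid E)
    (F : Fourientation E) (v : E → ℝ) : Prop :=
  IsSignedCocircuit M N v ∧ arcs v ⊆ rev Fᶜ

/-- The bases of a matroid. -/
abbrev Base {E : Type*} (N : Matroid E) : Type _ := {B : Set E // N.IsBase B}

/-- An external atlas: for each basis `B`, a fourientation in which the edges in `B` are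
bioriented and the edges outside `B` are one-way oriented. -/
structure ExternalAtlas {E : Type*} (N : Matroid E) where
  /-- the externally oriented basis attached to a basis -/
  fou : Base N → Fourientation E
  internal : ∀ B : Base N, ∀ e ∈ B.1, Bioriented (fou B) e
  external : ∀ B : Base N, ∀ e ∉ B.1, OneWay (fou B) e

/-- An internal atlas: for each basis `B`, a fourientation in which the edges outside `B` are
bioriented and the edges in `B` are one-way oriented. -/
structure InternalAtlas {E : Type*} (N : Matroid E) where
  /-- the internally oriented basis attached to a basis -/
  fou : Base N → Fourientation E
  internal : ∀ B : Base N, ∀ e ∈ B.1, OneWay (fou B) e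
  external : ∀ B : Base N, ∀ e ∉ B.1, Bioriented (fou B) e

def ExternalAtlas.Dissecting {E m : Type*} [Fintype m] {N : Matroid E}
    (A : ExternalAtlas N) (M : Matrix m E ℝ) : Prop :=
  ∀ B₁ B₂ : Base N, B₁ ≠ B₂ → ∃ v, IsPotentialCocircuit M N (A.fou B₁ ∩ rev (A.fou B₂)) v

def ExternalAtlas.Triangulating {E m : Type*} [Fintype E] {N : Matroid E}
    (A : ExternalAtlas N) (M : Matrix m E ℝ) : Prop :=
  ∀ B₁ B₂ : Base N, B₁ ≠ B₂ → ¬ ∃ v, IsPotentialCircuit M N (A.fou B₁ ∩ rev (A.fou B₂)) v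

def InternalAtlas.Dissecting {E m : Type*} [Fintype E] {N : Matroid E}
    (A : InternalAtlas N) (M : Matrix m E ℝ) : Prop :=
  ∀ B₁ B₂ : Base N, B₁ ≠ B₂ → ∃ v, IsPotentialCircuit M N (A.fou B₁ ∩ rev (A.fou B₂))ᶜ v

def InternalAtlas.Triangulating {E m : Type*} [Fintype m] {N : Matroid E}
    (A : InternalAtlas N) (M : Matrix m E ℝ) : Prop :=
  ∀ B₁ B₂ : Base N, B₁ ≠ B₂ → ¬ ∃ v, IsPotentialCocircuit M N (A.fou B₁ ∩ rev (A.fou B₂))ᶜ v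

/-- The map sending a basis `B` to the orientation that is the intersection of the two oriented
bases attached to `B`. -/
def basisMap {E : Type*} {N : Matroid E} (A : ExternalAtlas N) (A' : InternalAtlas N)
    (B : Base N) : Orientation E :=
  ⟨A.fou B ∩ A'.fou B, fun e => by
    by_cases he : e ∈ B.1
    · obtain ⟨s, hs, hu⟩ := A'.internal B e he
      exact ⟨s, ⟨A.internal B e he s, hs⟩, fun t ht => hu t ht.2⟩
    · obtain ⟨s, hs, hu⟩ := A.external B e he
      exact ⟨s, ⟨hs, A'.external B e he s⟩, fun t ht => hu t ht.1⟩⟩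

/-- `O₂` arises from `O₁` by replacing a signed circuit in `O₁` by its opposite. -/
def CircuitReversal {E m : Type*} [Fintype E] (M : Matrix m E ℝ) (N : Matroid E)
    (O₁ O₂ : Orientation E) : Prop :=
  ∃ v, IsSignedCircuit M N v ∧ arcs v ⊆ O₁.1 ∧ O₂.1 = (O₁.1 \ arcs v) ∪ arcs (-v)

/-- `O₂` arises from `O₁` by replacing a signed cocircuit in `O₁` by its opposite. -/
def CocircuitReversal {E m : Type*} [Fintype m] (M : Matrix m E ℝ) (N : Matroid E)
    (O₁ O₂ : Orientation E) : Prop :=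
  ∃ v, IsSignedCocircuit M N v ∧ arcs v ⊆ O₁.1 ∧ O₂.1 = (O₁.1 \ arcs v) ∪ arcs (-v)

/-- The two orientations are in the same circuit reversal class. -/
def SameCircuitClass {E m : Type*} [Fintype E] (M : Matrix m E ℝ) (N : Matroid E) :
    Orientation E → Orientation E → Prop :=
  Relation.EqvGen (CircuitReversal M N)

/-- The two orientations are in the same cocircuit reversal class. -/
def SameCocircuitClass {E m : Type*} [Fintype m] (M : Matrix m E ℝ) (N : Matroid E) :
    Orientation E → Orientation E → Prop :=
  Relation.EqvGen (CocircuitReversal M N)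

/-- The two orientations are in the same circuit-cocircuit reversal class. -/
def SameCircuitCocircuitClass {E m : Type*} [Fintype E] [Fintype m] (M : Matrix m E ℝ)
    (N : Matroid E) : Orientation E → Orientation E → Prop :=
  Relation.EqvGen fun O₁ O₂ => CircuitReversal M N O₁ O₂ ∨ CocircuitReversal M N O₁ O₂

/-- `O₂` is obtained from `O₁` by simultaneously reversing the signed circuits in `𝒞` and the
signed cocircuits in `𝒟`, all of them in `O₁` and with pairwise disjoint underlying edges. -/
structure DifferBy {E m : Type*} [Fintype E] [Fintype m] (M : Matrix m E ℝ) (N : Matroid E)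
    (O₁ O₂ : Orientation E) (𝒞 𝒟 : Set (E → ℝ)) : Prop where
  circuit : ∀ v ∈ 𝒞, IsSignedCircuit M N v ∧ arcs v ⊆ O₁.1
  cocircuit : ∀ v ∈ 𝒟, IsSignedCocircuit M N v ∧ arcs v ⊆ O₁.1
  disjoint_circuits : 𝒞.PairwiseDisjoint Function.support
  disjoint_cocircuits : 𝒟.PairwiseDisjoint Function.support
  disjoint_circuit_cocircuit :
    ∀ v ∈ 𝒞, ∀ w ∈ 𝒟, Disjoint (Function.support v) (Function.support w)
  eq : O₂.1 = (O₁.1 \ ⋃ v ∈ 𝒞 ∪ 𝒟, arcs v) ∪ ⋃ v ∈ 𝒞 ∪ 𝒟, arcs (-v)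

/-- `S = (B ∪ ⋃ C_i) \ ⋃ C_j^*` for some basis `B` whose associated orientation is in the
circuit-cocircuit reversal class of `O`, and some disjoint signed circuits `C_i` and signed
cocircuits `C_j^*` whose reversal turns that orientation into `O`. -/
def IsExtendedValue {E m : Type*} [Fintype E] [Fintype m] (M : Matrix m E ℝ) {N : Matroid E}
    (A : ExternalAtlas N) (A' : InternalAtlas N) (O : Orientation E) (S : Set E) : Prop :=
  ∃ (B : Base N) (𝒞 𝒟 : Set (E → ℝ)),
    SameCircuitCocircuitClass M N (basisMap A A' B) O ∧
    DifferBy M N (basisMap A A' B) O 𝒞 𝒟 ∧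
    S = (B.1 ∪ ⋃ v ∈ 𝒞, Function.support v) \ ⋃ v ∈ 𝒟, Function.support v

/-- Any two distinct orientations differ on an edge of the symmetric difference of their images. -/
def Tiling {E : Type*} (φ : Orientation E → Set E) : Prop :=
  ∀ O₁ O₂ : Orientation E, O₁ ≠ O₂ →
    ∃ e, restrict O₁.1 e ≠ restrict O₂.1 e ∧ e ∈ symmDiff (φ O₁) (φ O₂)

/-- `S` contains exactly one element of each class of the equivalence relation `R`. -/
def IsRepresentativeSet {α : Type*} (R : α → α → Prop) (S : Set α) : Prop :=
  ∀ x, ∃! y, y ∈ S ∧ R x y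

end RegularMatroid

/-!
Orientations are handled as `±1`-vectors. The spaces `V = ker M` and `W = im Mᵀ` are orthogonal
complements, and to every nonzero vector of either space conforms some signed (co)circuit.

*Uniqueness.* Let `f₁`, `f₂` be the orientations of bases `B₁ ≠ B₂`, and reverse in `fᵢ` circuits
with sum `cᵢ ∈ V` and cocircuits with sum `dᵢ ∈ W`. Suppose that the results agree on every edge
where the sets assigned to them differ. If the external atlas is triangulating, Farkas' lemma yields
`w ∈ W` with prescribed signs, while the dissecting internal atlas provides a signed circuit `C`.
The orthogonal vectors `C + 2(c₁ - c₂)` and `w + 2(d₂ - d₁)` then have a nonnegative product at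
every edge, so all these products vanish, and the support of `C` lies in `B₁`, which is absurd. If
the internal atlas is triangulating, the argument is dual. Hence distinct bases give inequivalent
orientations, and the extended map is tiling, so bijective by counting.

*Existence.* Fix a generic weight. An orientation of maximal weight in its reversal class is, by
linear programming duality, optimal for some basis, and each basis is optimal for at most one class.
So there are at most as many classes as bases, and every class contains the orientation of a basis.
Equivalent orientations differ by the sum of an even vector of `V` and an even vector of `W`, and
orthogonality of the two turns the difference into disjoint reversals.
-/

namespace RegularMatroid

/-- **Farkas' lemma** for finitely many linear functionals. -/
theorem mem_hull_of_forall_nonneg {K X ι : Type*} [Field K] [LinearOrder K]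
    [IsStrictOrderedRing K] [AddCommGroup X] [Module K X] {s : Finset ι}
    {a : ι → Module.Dual K X} {b : Module.Dual K X}
    (h : ∀ x, (∀ i ∈ s, 0 ≤ a i x) → 0 ≤ b x) : b ∈ PointedCone.hull K (a '' s) := by
  classical
  induction s using Finset.induction_on generalizing a b with
  | empty =>
    have hb : b = 0 := by
      ext x
      exact le_antisymm (by simpa using h (-x) (by simp)) (h x (by simp))
    simp [hb]
  | insert j s _ ih =>
    by_cases hs : ∀ x, (∀ i ∈ s, 0 ≤ a i x) → 0 ≤ b x
    · exact Submodule.span_mono (Set.image_mono (by simp)) (ih hs)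
    push Not at hs
    obtain ⟨x, hx, hbx⟩ := hs
    have hjx : a j x < 0 := lt_of_not_ge fun hjx =>
      hbx.not_ge (h x (Finset.forall_mem_insert _ _ _ |>.2 ⟨hjx, hx⟩))
    -- the projection of the dual space along `a j` onto the functionals vanishing at `x`
    let π : Module.Dual K X →ₗ[K] Module.Dual K X :=
      LinearMap.id - ((a j x)⁻¹ • Module.Dual.eval K X x).smulRight (a j)
    have hπ (f : Module.Dual K X) (y : X) : π f y = f (y - (a j y / a j x) • x) := by
      simp [π]; ring
    have hπb : π b ∈ PointedCone.hull K ((fun i => π (a i)) '' s) := ih fun y hy => by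
      rw [hπ]
      refine h _ (Finset.forall_mem_insert _ _ _ |>.2 ⟨?_, fun i hi => hπ (a i) y ▸ hy i hi⟩)
      simp [hjx.ne]
    obtain ⟨f, hf, hfb⟩ : ∃ f ∈ PointedCone.hull K (a '' s), π f = π b := by
      rw [← Set.image_image π a] at hπb
      rwa [← PointedCone.mem_map, PointedCone.map, PointedCone.hull, Submodule.map_span]
    have hfx : 0 ≤ f x := by
      have hle : PointedCone.hull K (a '' s) ≤
          (PointedCone.positive K K).comap (Module.Dual.eval K X x) :=
        Submodule.span_le.2 (Set.forall_mem_image.2 hx)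
      exact hle hf
    have hb : b = ((b x - f x) / a j x) • a j + f := by
      ext y
      have := LinearMap.congr_fun hfb y
      simp only [hπ, map_sub, map_smul, smul_eq_mul] at this
      simp only [LinearMap.add_apply, LinearMap.smul_apply, smul_eq_mul]
      linear_combination -this
    rw [hb, Finset.coe_insert, Set.image_insert_eq]
    exact Submodule.mem_span_insert.2 ⟨⟨_, div_nonneg_of_nonpos (by linarith) hjx.le⟩, f, hf, rfl⟩

theorem farkas {K X ι : Type*} [Field K] [LinearOrder K] [IsStrictOrderedRing K] [AddCommGroup X]
    [Module K X] [Fintype ι] {a : ι → Module.Dual K X} {b : Module.Dual K X}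
    (h : ∀ x, (∀ i, 0 ≤ a i x) → 0 ≤ b x) :
    ∃ c : ι → K, (∀ i, 0 ≤ c i) ∧ ∀ x, b x = ∑ i, c i * a i x := by
  have hb := mem_hull_of_forall_nonneg (s := Finset.univ) (by simpa using h)
  rw [Finset.coe_univ, Set.image_univ, PointedCone.hull,
    Submodule.mem_span_range_iff_exists_fun] at hb
  obtain ⟨c, rfl⟩ := hb
  exact ⟨fun i => c i, fun i => (c i).2, fun x => LinearMap.sum_apply _ _ x⟩

section Conformal

variable {E : Type*}

/-- `c` conforms to `v`: on the support of `c` the two vectors have the same nonzero signs. -/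
def Conforms (c v : E → ℝ) : Prop := ∀ e, c e ≠ 0 → 0 < c e * v e

theorem Conforms.refl (v : E → ℝ) : Conforms v v := fun _ he => mul_self_pos.2 he

theorem Conforms.trans {b c v : E → ℝ} (hbc : Conforms b c) (hcv : Conforms c v) :
    Conforms b v := by
  intro e he
  have hb := hbc e he
  have hc := hcv e (right_ne_zero_of_mul hb.ne')
  have : 0 < c e * c e * (b e * v e) := by linarith [mul_pos hb hc]
  exact pos_of_mul_pos_right this (mul_self_nonneg _)

theorem Conforms.support_subset {c v : E → ℝ} (h : Conforms c v) :
    Function.support c ⊆ Function.support v :=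
  fun e he => right_ne_zero_of_mul (h e he).ne'

theorem exists_conforms_sub_smul [Finite E] {u v : E → ℝ}
    (huv : Function.support u ⊆ Function.support v) (hpos : ∃ e, 0 < u e * v e) :
    ∃ t : ℝ, 0 < t ∧ Conforms (v - t • u) v ∧
      Function.support (v - t • u) ⊂ Function.support v := by
  classical
  obtain ⟨e₁, he₁, hmin⟩ := Set.exists_min_image {e | 0 < u e * v e} (fun e => v e / u e)
    (Set.toFinite _) hpos
  have hdiv {e} (he : 0 < u e * v e) : 0 < v e / u e := by
    rw [← mul_div_mul_left _ _ (left_ne_zero_of_mul he.ne')]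
    exact div_pos he (mul_self_pos.2 (left_ne_zero_of_mul he.ne'))
  set t := v e₁ / u e₁
  have ht : 0 < t := hdiv he₁
  have hsq (e : E) : t * (u e * v e) ≤ v e * v e := by
    rcases le_or_gt (u e * v e) 0 with h | h
    · exact (mul_nonpos_of_nonneg_of_nonpos ht.le h).trans (mul_self_nonneg _)
    · calc t * (u e * v e) ≤ v e / u e * (u e * v e) := mul_le_mul_of_nonneg_right (hmin e h) h.le
        _ = v e * v e := by rw [← mul_assoc, div_mul_cancel₀ _ (left_ne_zero_of_mul h.ne')]
  have hsub : Function.support (v - t • u) ⊆ Function.support v := fun e he hv => he <| by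
    simp [hv, Function.notMem_support.1 fun hu => huv hu hv]
  refine ⟨t, ht, fun e he => ?_, hsub, fun hsup => ?_⟩
  · refine lt_of_le_of_ne ?_ (mul_ne_zero he (hsub he)).symm
    simp only [Pi.sub_apply, Pi.smul_apply, smul_eq_mul]
    linarith [hsq e]
  · have hu₁ : u e₁ ≠ 0 := left_ne_zero_of_mul (ne_of_gt he₁)
    exact hsup (huv hu₁) (by simp [t, hu₁])

theorem exists_conforms_ssubset [Finite E] {V : Submodule ℝ (E → ℝ)} {u v : E → ℝ} (hu : u ∈ V)
    (hv : v ∈ V) (hu0 : u ≠ 0) (huv : Function.support u ⊂ Function.support v) {e : E}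
    (he : v e ≠ 0) :
    ∃ v' ∈ V, Conforms v' v ∧ Function.support v' ⊂ Function.support v ∧ v' e ≠ 0 := by
  wlog hue : u e * v e ≤ 0 generalizing u
  · exact this (V.neg_mem hu) (neg_ne_zero.2 hu0) (by simpa using huv) (by simp; linarith)
  have of_pos {u' : E → ℝ} (hu' : u' ∈ V) (hsub : Function.support u' ⊂ Function.support v)
      (hu'e : u' e * v e ≤ 0) (hpos : ∃ f, 0 < u' f * v f) :
      ∃ v' ∈ V, Conforms v' v ∧ Function.support v' ⊂ Function.support v ∧ v' e ≠ 0 := by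
    obtain ⟨t, ht, hconf, hlt⟩ := exists_conforms_sub_smul hsub.le hpos
    refine ⟨v - t • u', V.sub_mem hv (V.smul_mem t hu'), hconf, hlt, left_ne_zero_of_mul
      (b := v e) (ne_of_gt ?_)⟩
    have : (v - t • u') e * v e = v e * v e - t * (u' e * v e) := by
      simp only [Pi.sub_apply, Pi.smul_apply, smul_eq_mul]; ring
    linarith [mul_self_pos.2 he, mul_nonpos_of_nonneg_of_nonpos ht.le hu'e]
  by_cases hpos : ∃ f, 0 < u f * v f
  · exact of_pos hu huv hue hpos
  push Not at hpos
  have hneg : Conforms (-u) v := fun f hf => by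
    have huf : u f ≠ 0 := by simpa using hf
    have := lt_of_le_of_ne (hpos f) (mul_ne_zero huf (huv.le huf))
    simpa using this
  by_cases hue0 : u e = 0
  · obtain ⟨f, hf⟩ := Function.ne_iff.1 (neg_ne_zero.2 hu0)
    exact of_pos (V.neg_mem hu) (by simpa using huv) (by simp [hue0]) ⟨f, hneg f hf⟩
  · exact ⟨-u, V.neg_mem hu, hneg, by simpa using huv, by simpa using hue0⟩

theorem exists_conforms_minimal [Finite E] {V : Submodule ℝ (E → ℝ)} {v : E → ℝ} (hv : v ∈ V)
    {e : E} (he : v e ≠ 0) :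
    ∃ c ∈ V, Conforms c v ∧ c e ≠ 0 ∧
      ∀ u ∈ V, Function.support u ⊂ Function.support c → u = 0 := by
  by_cases hmin : ∀ u ∈ V, Function.support u ⊂ Function.support v → u = 0
  · exact ⟨v, hv, .refl v, he, hmin⟩
  push Not at hmin
  obtain ⟨u, hu, huv, hu0⟩ := hmin
  obtain ⟨v', hv', hconf, hlt, hv'e⟩ := exists_conforms_ssubset hu hv hu0 huv he
  obtain ⟨c, hc, hcv', hce, hcmin⟩ := exists_conforms_minimal hv' hv'e
  exact ⟨c, hc, hcv'.trans hconf, hce, hcmin⟩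
termination_by (Function.support v).ncard
decreasing_by exact Set.ncard_lt_ncard hlt (Set.toFinite _)

end Conformal

section TotallyUnimodular

theorem exists_det_submatrix_ne_zero {K m J : Type*} [Field K] [Finite m] [Fintype J]
    [DecidableEq J] {A : Matrix m J K} (hA : LinearIndependent K A.col) :
    ∃ r : J → m, (A.submatrix r id).det ≠ 0 := by
  have := Fintype.ofFinite m
  have hrank : Fintype.card J = Module.finrank K (Submodule.span K (Set.range A.row)) := by
    rw [← Matrix.rank_eq_finrank_span_row, ← Matrix.rank_transpose]
    exact (LinearIndependent.rank_matrix hA).symm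
  obtain ⟨f, hf, -, hli⟩ := Submodule.exists_fun_fin_finrank_span_eq K (Set.range A.row)
  choose r hr using hf
  let e : J ≃ Fin _ := Fintype.equivFinOfCardEq hrank
  refine ⟨r ∘ e, ?_⟩
  have hrow : LinearIndependent K (A.submatrix (r ∘ e) id).row := by
    have : (A.submatrix (r ∘ e) id).row = f ∘ e := funext fun j => hr (e j)
    rw [this]
    exact hli.comp e e.injective
  rw [Matrix.linearIndependent_rows_iff_isUnit, Matrix.isUnit_iff_isUnit_det] at hrow
  exact hrow.ne_zero

variable {E m : Type*} [Finite m] {M : Matrix m E ℝ}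

-- Cramer's rule writes each coefficient as a quotient of two minors of `M`.
theorem isSignVector_of_mulVec_eq_col {J : Type*} [Fintype J] (hM : M.IsTotallyUnimodular)
    {g : J → E} (hg : LinearIndependent ℝ (M.submatrix id g).col) {f : E} {x : J → ℝ}
    (hx : M.submatrix id g *ᵥ x = M.col f) : IsSignVector x := by
  classical
  intro j
  obtain ⟨r, hr⟩ := exists_det_submatrix_ne_zero hg
  set A := M.submatrix r g
  have hAx : A *ᵥ x = fun i => M (r i) f := funext fun i => congrFun hx (r i)
  have hcramer : (M.submatrix r (Function.update g j f)).det = A.det * x j := by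
    have hupd : M.submatrix r (Function.update g j f) = A.updateCol j (A *ᵥ x) := by
      ext i k
      rcases eq_or_ne k j with rfl | hk <;> simp [*, A]
    rw [hupd, ← Matrix.cramer_apply, Matrix.cramer_eq_adjugate_mulVec, Matrix.mulVec_mulVec,
      Matrix.adjugate_mul, Matrix.smul_mulVec, Matrix.one_mulVec, Pi.smul_apply, smul_eq_mul]
  rw [Matrix.isTotallyUnimodular_iff_fintype] at hM
  obtain ⟨s, hs⟩ := hM J r g
  obtain ⟨s', hs'⟩ := hM J r (Function.update g j f)
  rw [← hs', ← hs] at hcramer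
  have hs0 : s ≠ 0 := by rintro rfl; exact hr (by simpa using hs.symm)
  have hx' : x j = s * s' := by
    cases s <;> cases s' <;> simp at hs0 hcramer ⊢ <;> linarith
  rw [hx']
  cases s <;> cases s' <;> simp

end TotallyUnimodular

section UnimodularSpace

variable {E : Type*} {N : Matroid E} {V W : Submodule ℝ (E → ℝ)}

/-- The space `V` represents the circuits of `N` regularly: the circuits are the minimal supports
of the nonzero vectors of `V`, and a vector supported on a circuit has constant absolute value
there. -/
structure UnimodularSpace (N : Matroid E) (V : Submodule ℝ (E → ℝ)) : Prop where
  ground : N.E = Set.univ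
  indep_iff (I : Set E) : N.Indep I ↔ ∀ v ∈ V, Function.support v ⊆ I → v = 0
  abs_eq_abs {v : E → ℝ} (hv : v ∈ V) (hc : N.IsCircuit (Function.support v)) {e f : E}
    (he : v e ≠ 0) (hf : v f ≠ 0) : |v e| = |v f|

/-- A `{0, ±1}`-vector of `V` whose support is a circuit: the signed circuits of `N` are those of
`ker M`, its signed cocircuits are the signed circuits of `N✶` in `im Mᵀ`. -/
structure SignedCircuitIn (N : Matroid E) (V : Submodule ℝ (E → ℝ)) (v : E → ℝ) : Prop where
  sign : IsSignVector v
  mem : v ∈ V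
  circuit : N.IsCircuit (Function.support v)

theorem SignedCircuitIn.ne_zero {v : E → ℝ} (h : SignedCircuitIn N V v) : v ≠ 0 := by
  rintro rfl
  exact N.empty_not_isCircuit (by simpa using h.circuit)

theorem IsSignVector.neg {v : E → ℝ} (h : IsSignVector v) : IsSignVector (-v) := fun e => by
  rcases h e with h | h | h <;> simp [h]

theorem SignedCircuitIn.neg {v : E → ℝ} (h : SignedCircuitIn N V v) :
    SignedCircuitIn N V (-v) :=
  ⟨h.sign.neg, V.neg_mem h.mem, by simpa using h.circuit⟩

theorem UnimodularSpace.isCircuit_support (h : UnimodularSpace N V) {c : E → ℝ} (hc : c ∈ V)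
    (hc0 : c ≠ 0) (hmin : ∀ u ∈ V, Function.support u ⊂ Function.support c → u = 0) :
    N.IsCircuit (Function.support c) := by
  rw [Matroid.isCircuit_iff_forall_ssubset]
  exact ⟨⟨fun hi => hc0 ((h.indep_iff _).1 hi c hc le_rfl), by simp [h.ground]⟩, fun I hI =>
    (h.indep_iff I).2 fun u hu huI => hmin u hu (huI.trans_ssubset hI)⟩

theorem UnimodularSpace.exists_conforms_apply_ne_zero [Finite E] (h : UnimodularSpace N V)
    {v : E → ℝ} (hv : v ∈ V) {e : E} (he : v e ≠ 0) :
    ∃ c, SignedCircuitIn N V c ∧ Conforms c v ∧ c e ≠ 0 := by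
  obtain ⟨c, hc, hcv, hce, hmin⟩ := exists_conforms_minimal hv he
  have hcirc := h.isCircuit_support hc (Function.ne_iff.2 ⟨e, hce⟩) hmin
  have hpos : 0 < |c e|⁻¹ := inv_pos.2 (abs_pos.2 hce)
  refine ⟨|c e|⁻¹ • c, ⟨fun f => ?_, V.smul_mem _ hc, ?_⟩, fun f hf => ?_, ?_⟩
  · by_cases hf : c f = 0
    · simp [hf]
    · rw [Pi.smul_apply, smul_eq_mul, h.abs_eq_abs hc hcirc hce hf, inv_mul_eq_div]
      rcases abs_choice (c f) with h' | h' <;> rw [h'] <;> simp [hf]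
  · rwa [Function.support_const_smul_of_ne_zero _ _ hpos.ne']
  · rw [Pi.smul_apply, smul_eq_mul, mul_assoc]
    exact mul_pos hpos (hcv f (right_ne_zero_of_mul hf))
  · exact mul_ne_zero hpos.ne' hce

theorem UnimodularSpace.exists_conforms [Finite E] (h : UnimodularSpace N V) {v : E → ℝ}
    (hv : v ∈ V) (hv0 : v ≠ 0) : ∃ c, SignedCircuitIn N V c ∧ Conforms c v := by
  obtain ⟨e, he⟩ := Function.ne_iff.1 hv0
  obtain ⟨c, hc, hcv, -⟩ := h.exists_conforms_apply_ne_zero hv he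
  exact ⟨c, hc, hcv⟩

theorem UnimodularSpace.indep_compl (h : UnimodularSpace N V) {B : Set E}
    (hB : N.IsBase B) : N✶.Indep Bᶜ := by
  simpa only [h.ground, ← Set.compl_eq_univ_sdiff] using hB.compl_isBase_dual.indep

theorem UnimodularSpace.exists_support_subset_insert [Finite E] (h : UnimodularSpace N V)
    {B : Set E} (hB : N.IsBase B) {f : E} (hf : f ∉ B) :
    ∃ v ∈ V, N.IsCircuit (Function.support v) ∧ Function.support v ⊆ insert f B ∧ v f ≠ 0 := by
  have hdep := (hB.insert_dep ⟨by simp [h.ground], hf⟩).not_indep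
  rw [h.indep_iff] at hdep
  push Not at hdep
  obtain ⟨v, hv, hvB, hv0⟩ := hdep
  obtain ⟨c, hc, hcv⟩ := h.exists_conforms hv hv0
  have hcB := hcv.support_subset.trans hvB
  refine ⟨c, hc.mem, hc.circuit, hcB, fun hcf => hc.ne_zero ?_⟩
  exact (h.indep_iff B).1 hB.indep c hc.mem fun e he =>
    (hcB he).resolve_left fun hef => he (hef ▸ hcf)

end UnimodularSpace

section Kernel

variable {E m : Type*} [Fintype E] {M : Matrix m E ℝ} {N : Matroid E}

theorem indep_iff_ker (hMN : Represents M N) (I : Set E) :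
    N.Indep I ↔ ∀ v ∈ LinearMap.ker M.mulVecLin, Function.support v ⊆ I → v = 0 := by
  have hcomb (l : E →₀ ℝ) : Finsupp.linearCombination ℝ M.col l = M *ᵥ l := by
    ext i
    rw [Finsupp.linearCombination_apply, Finsupp.sum_fintype _ _ (by simp)]
    simp [Matrix.mulVec, dotProduct, Matrix.col, mul_comm]
  rw [hMN.2 I, linearIndepOn_iff]
  refine ⟨fun h v hv hvI => ?_, fun h l hl hl0 => ?_⟩
  · have := h (Finsupp.equivFunOnFinite.symm v) (by simpa [Finsupp.mem_supported] using hvI)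
      (by simpa [hcomb] using hv)
    exact funext fun e => DFunLike.congr_fun this e
  · exact DFunLike.coe_injective (h l (by simpa [hcomb] using hl0)
      (by simpa [Finsupp.mem_supported] using hl))

theorem unimodularSpace_ker [Finite m] (hM : M.IsTotallyUnimodular) (hMN : Represents M N) :
    UnimodularSpace N (LinearMap.ker M.mulVecLin) := by
  classical
  refine ⟨hMN.1, indep_iff_ker hMN, fun {v} hv hc e f he hf => ?_⟩
  rcases eq_or_ne e f with rfl | hef
  · rfl
  let J : Set E := Function.support v \ {f}
  let x : E → ℝ := Pi.single f 1 - (v f)⁻¹ • v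
  have hxJ {j : E} (hj : j ∉ J) : x j = 0 := by
    rcases eq_or_ne j f with rfl | hjf
    · simp_all [x]
    · have : v j = 0 := by simpa [J, hjf] using hj
      simp [x, hjf, this]
  have hMx : M.submatrix id ((↑) : J → E) *ᵥ (fun j => x j) = M.col f := by
    have : M *ᵥ x = M.col f := by
      have : M *ᵥ v = 0 := hv
      simp [x, Matrix.mulVec_sub, Matrix.mulVec_smul, this]
    rw [← this]
    ext i
    exact Fintype.sum_of_injective _ Subtype.val_injective _ _
      (fun j hj => by simp [hxJ (by simpa using hj)]) fun _ => rfl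
  have hxe' := isSignVector_of_mulVec_eq_col hM ((hMN.2 J).1 (hc.sdiff_singleton_indep hf)) hMx
    ⟨e, he, hef⟩
  have hxe : x e = -(v e / v f) := by simp [x, hef, div_eq_inv_mul]
  have : |v e / v f| = 1 := by
    rw [hxe, neg_eq_zero, neg_inj, neg_eq_iff_eq_neg, div_eq_zero_iff] at hxe'
    rcases hxe' with h | h | h
    · exact absurd h (by tauto)
    · simp [h]
    · simp [h]
  rwa [abs_div, div_eq_one_iff_eq (abs_ne_zero.2 hf)] at this

variable [Fintype m]

theorem mem_ker_iff_forall_dotProduct_eq_zero (v : E → ℝ) :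
    v ∈ LinearMap.ker M.mulVecLin ↔ ∀ w ∈ LinearMap.range Mᵀ.mulVecLin, v ⬝ᵥ w = 0 := by
  simp only [LinearMap.mem_ker, LinearMap.mem_range, Matrix.mulVecLin_apply]
  constructor
  · rintro h _ ⟨u, rfl⟩
    rw [Matrix.dotProduct_mulVec, Matrix.vecMul_transpose, h, zero_dotProduct]
  · intro h
    have := h _ ⟨M *ᵥ v, rfl⟩
    rwa [Matrix.dotProduct_mulVec, Matrix.vecMul_transpose, dotProduct_self_eq_zero] at this

theorem mem_range_iff_forall_dotProduct_eq_zero (w : E → ℝ) :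
    w ∈ LinearMap.range Mᵀ.mulVecLin ↔ ∀ v ∈ LinearMap.ker M.mulVecLin, w ⬝ᵥ v = 0 := by
  classical
  refine ⟨fun hw v hv => dotProduct_comm w v ▸
    (mem_ker_iff_forall_dotProduct_eq_zero v).1 hv w hw, fun h => ?_⟩
  have hw : dotProductEquiv ℝ E w ∈ LinearMap.range M.mulVecLin.dualMap := by
    rw [LinearMap.range_dualMap_eq_dualAnnihilator_ker, Submodule.mem_dualAnnihilator]
    exact h
  obtain ⟨ψ, hψ⟩ := hw
  obtain ⟨u, rfl⟩ := (dotProductEquiv ℝ m).surjective ψ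
  have hu (v : E → ℝ) : u ⬝ᵥ M *ᵥ v = w ⬝ᵥ v := LinearMap.congr_fun hψ v
  refine ⟨u, (dotProductEquiv ℝ E).injective (LinearMap.ext fun v => ?_)⟩
  simpa [Matrix.dotProduct_mulVec, Matrix.mulVec_transpose] using hu v

end Kernel

section OrthogonalPair

variable {E : Type*} [Fintype E] {N : Matroid E} {V W : Submodule ℝ (E → ℝ)}

theorem exists_pos_of_orthogonal (hW : ∀ w, (∀ v ∈ V, w ⬝ᵥ v = 0) → w ∈ W) {s : E → ℝ}
    {P Z : Set E} (hPZ : Disjoint P Z) (hs : ∀ e ∈ P, s e ≠ 0)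
    (hV : ∀ v ∈ V, (∀ e ∈ Z, v e = 0) → (∀ e ∈ P, 0 ≤ s e * v e) → ∀ e ∈ P, s e * v e = 0) :
    ∃ w ∈ W, (∀ e ∈ P, 0 < s e * w e) ∧ ∀ e ∉ P, e ∉ Z → w e = 0 := by
  classical
  let a : Option ℤˣ → E → ℝ
    | none => P.indicator s
    | some u => Z.indicator fun _ => (u : ℤ)
  let ev (e : E) : V →ₗ[ℝ] ℝ := LinearMap.proj e ∘ₗ V.subtype
  obtain ⟨c, hc, hb⟩ := farkas (a := fun i : Option ℤˣ × E => a i.1 i.2 • ev i.2)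
    (b := -∑ e, P.indicator s e • ev e) fun v hv => by
      have hZ (e) (he : e ∈ Z) : v.1 e = 0 := by
        have h₁ : 0 ≤ v.1 e := by simpa [a, ev, he] using hv (some 1, e)
        have h₂ : v.1 e ≤ 0 := by simpa [a, ev, he] using hv (some (-1), e)
        exact h₂.antisymm h₁
      have hP := hV v v.2 hZ fun e he => by simpa [a, ev, he] using hv (none, e)
      have h0 (e) : P.indicator s e * v.1 e = 0 := by
        by_cases he : e ∈ P <;> simp [he, hP]
      simp [ev, h0]
  refine ⟨fun e => P.indicator s e + ∑ i, c (i, e) * a i e, hW _ fun v hv => ?_,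
    fun e he => ?_, fun e heP heZ => ?_⟩
  · have := hb ⟨v, hv⟩
    simp only [ev, LinearMap.neg_apply, LinearMap.sum_apply, LinearMap.smul_apply, smul_eq_mul,
      LinearMap.comp_apply, LinearMap.proj_apply, Submodule.subtype_apply,
      Fintype.sum_prod_type_right] at this
    simp only [dotProduct, add_mul, Finset.sum_add_distrib, Finset.sum_mul, mul_assoc, ← this]
    exact add_neg_cancel _
  · have heZ := hPZ.notMem_of_mem_left he
    simp only [Fintype.sum_option, a, Set.indicator_of_mem he, Set.indicator_of_notMem heZ,
      mul_zero, Finset.sum_const_zero, add_zero]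
    have : s e * (s e + c (none, e) * s e) = (1 + c (none, e)) * (s e * s e) := by ring
    exact this ▸ mul_pos (by linarith [hc (none, e)]) (mul_self_pos.2 (hs e he))
  · simp [Fintype.sum_option, a, heP, heZ]

/-- Orthogonal complements `V` and `W` in `E → ℝ` representing the circuits of `N` and of the dual
matroid: for a regular matroid these are `ker M` and `im Mᵀ`. The notion is self-dual, so every
result about circuits has a counterpart for cocircuits. -/
structure RegularPair (N : Matroid E) (V W : Submodule ℝ (E → ℝ)) : Prop where
  left : UnimodularSpace N V
  right : UnimodularSpace N✶ W
  mem_left (v : E → ℝ) : v ∈ V ↔ ∀ w ∈ W, v ⬝ᵥ w = 0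
  mem_right (w : E → ℝ) : w ∈ W ↔ ∀ v ∈ V, w ⬝ᵥ v = 0

theorem RegularPair.dual (h : RegularPair N V W) : RegularPair N✶ W V :=
  ⟨h.right, by simpa using h.left, h.mem_right, h.mem_left⟩

theorem RegularPair.dotProduct_eq_zero (h : RegularPair N V W) {v w : E → ℝ} (hv : v ∈ V)
    (hw : w ∈ W) : v ⬝ᵥ w = 0 :=
  (h.mem_left v).1 hv w hw

theorem UnimodularSpace.coindep_iff (h : UnimodularSpace N V)
    (hW : ∀ w, w ∈ W ↔ ∀ v ∈ V, w ⬝ᵥ v = 0) (I : Set E) :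
    N✶.Indep I ↔ ∀ w ∈ W, Function.support w ⊆ I → w = 0 := by
  refine ⟨fun hI w hw hwI => ?_, fun hI => ?_⟩
  · obtain ⟨-, B, hB, hIB⟩ := Matroid.dual_indep_iff_exists'.1 hI
    funext e
    by_contra hwe
    obtain ⟨v, hv, -, hvB, hve⟩ :=
      h.exists_support_subset_insert hB (hIB.notMem_of_mem_left (hwI hwe))
    have horth := (hW w).1 hw v hv
    rw [dotProduct, Fintype.sum_eq_single e fun f hf => ?_] at horth
    · exact mul_ne_zero hwe hve horth
    · by_contra hfvw
      exact hIB.le_bot ⟨hwI (left_ne_zero_of_mul hfvw),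
        (hvB (right_ne_zero_of_mul hfvw)).resolve_left hf⟩
  · by_contra hdep
    obtain ⟨e, he⟩ : ∃ e, e ∉ N.closure Iᶜ := by
      by_contra! hall
      refine hdep ((Matroid.coindep_iff_closure_compl_eq_ground (by simp [h.ground])).2 ?_)
      rw [h.ground, ← Set.compl_eq_univ_sdiff]
      exact Set.eq_univ_of_forall hall
    have heI : e ∈ I := by
      by_contra heI
      exact he (N.mem_closure_of_mem heI (by simp [h.ground]))
    obtain ⟨w, hw, hwe, hwI⟩ := exists_pos_of_orthogonal (s := 1) (fun w => (hW w).2)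
      (P := {e}) (Z := I \ {e}) (by simp) (by simp) fun v hv hvI _ => by
        by_contra! hve
        obtain ⟨c, hc, hcv, hce⟩ := h.exists_conforms_apply_ne_zero hv (e := e) (by simpa using hve)
        refine he (N.closure_subset_closure ?_ (hc.circuit.mem_closure_sdiff_singleton_of_mem hce))
        exact fun f hf hfI => hcv.support_subset hf.1 (hvI f ⟨hfI, hf.2⟩)
    refine (hwe e rfl).ne' ?_
    rw [hI w hw fun f hf => ?_, Pi.zero_apply, mul_zero]
    by_contra hfI
    exact hf (hwI f (fun hfe => hfI (hfe ▸ heI)) fun hfI' => hfI hfI'.1)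

theorem UnimodularSpace.abs_eq_abs_of_isCocircuit (h : UnimodularSpace N V)
    (hW : ∀ w ∈ W, ∀ v ∈ V, w ⬝ᵥ v = 0) {w : E → ℝ} (hw : w ∈ W)
    (hc : N.IsCocircuit (Function.support w)) {e f : E} (he : w e ≠ 0) (hf : w f ≠ 0) :
    |w e| = |w f| := by
  rcases eq_or_ne e f with rfl | hef
  · rfl
  obtain ⟨-, B, hB, hwB⟩ := Matroid.dual_indep_iff_exists'.1 (hc.sdiff_singleton_indep he)
  obtain ⟨v, hv, hvc, hvB, hvf⟩ :=
    h.exists_support_subset_insert hB (hwB.notMem_of_mem_left ⟨hf, hef.symm⟩)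
  have horth := hW w hw v hv
  rw [dotProduct, Fintype.sum_eq_add e f hef fun g hg => ?_] at horth
  · have hve : v e ≠ 0 := fun hve => by simp [hve, hf, hvf] at horth
    have habs : |w e| * |v e| = |w f| * |v f| := by
      rw [← abs_mul, ← abs_mul, eq_neg_of_add_eq_zero_left horth, abs_neg]
    rw [h.abs_eq_abs hv hvc hve hvf] at habs
    exact mul_right_cancel₀ (abs_ne_zero.2 hvf) habs
  · by_contra hgwv
    exact hwB.le_bot ⟨⟨left_ne_zero_of_mul hgwv, hg.1⟩,
      (hvB (right_ne_zero_of_mul hgwv)).resolve_left hg.2⟩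

theorem UnimodularSpace.regularPair (h : UnimodularSpace N V)
    (hV : ∀ v, v ∈ V ↔ ∀ w ∈ W, v ⬝ᵥ w = 0) (hW : ∀ w, w ∈ W ↔ ∀ v ∈ V, w ⬝ᵥ v = 0) :
    RegularPair N V W :=
  ⟨h, ⟨h.ground, h.coindep_iff hW, h.abs_eq_abs_of_isCocircuit fun w => (hW w).1⟩, hV, hW⟩

theorem regularPair_ker_range {m : Type*} [Fintype m] {M : Matrix m E ℝ}
    (hM : M.IsTotallyUnimodular) (hMN : Represents M N) :
    RegularPair N (LinearMap.ker M.mulVecLin) (LinearMap.range Mᵀ.mulVecLin) :=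
  (unimodularSpace_ker hM hMN).regularPair mem_ker_iff_forall_dotProduct_eq_zero
    mem_range_iff_forall_dotProduct_eq_zero

end OrthogonalPair

section Reversals

variable {E : Type*} {N : Matroid E} {V W : Submodule ℝ (E → ℝ)} {o o' : E → ℝ}

/-- Orientations in the vector model: all entries are `1` or `-1`. -/
def IsOrient (o : E → ℝ) : Prop := ∀ e, o e = 1 ∨ o e = -1

theorem IsOrient.ne_zero (ho : IsOrient o) (e : E) : o e ≠ 0 := by
  rcases ho e with h | h <;> simp [h]

theorem IsOrient.mul_self (ho : IsOrient o) (e : E) : o e * o e = 1 := by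
  rcases ho e with h | h <;> simp [h]

/-- The arcs of `c` belong to `o`, in the vector model. -/
def ContainedIn (c o : E → ℝ) : Prop := ∀ e, c e ≠ 0 → c e = o e

theorem ContainedIn.trans {b c : E → ℝ} (hbc : ContainedIn b c) (hco : ContainedIn c o) :
    ContainedIn b o := fun e he =>
  (hbc e he).trans (hco e (hbc e he ▸ he))

theorem ContainedIn.isSignVector {c : E → ℝ} (hco : ContainedIn c o) (ho : IsSignVector o) :
    IsSignVector c := fun e => by
  by_cases he : c e = 0
  · exact Or.inl he
  · exact hco e he ▸ ho e

theorem IsOrient.isSignVector (ho : IsOrient o) : IsSignVector o := fun e => Or.inr (ho e)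

theorem Conforms.containedIn {c v : E → ℝ} (hc : IsSignVector c) (hv : IsSignVector v)
    (h : Conforms c v) : ContainedIn c v := fun e he => by
  have hpos := h e he
  rcases hc e with h₁ | h₁ | h₁ <;> rcases hv e with h₂ | h₂ | h₂ <;>
    simp only [h₁, h₂] at hpos ⊢ <;> norm_num at hpos

theorem IsOrient.sub_two_smul (ho : IsOrient o) {c : E → ℝ} (hco : ContainedIn c o) :
    IsOrient (o - (2 : ℝ) • c) := fun e => by
  simp only [Pi.sub_apply, Pi.smul_apply, smul_eq_mul]
  by_cases hce : c e = 0
  · simpa [hce] using ho e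
  · rw [hco e hce]
    rcases ho e with h | h <;> rw [h] <;> norm_num

/-- Reversal of a signed circuit contained in `o`. -/
def CircuitStep (N : Matroid E) (V : Submodule ℝ (E → ℝ)) (o o' : E → ℝ) : Prop :=
  ∃ c, SignedCircuitIn N V c ∧ ContainedIn c o ∧ o' = o - (2 : ℝ) • c

theorem CircuitStep.symm (h : CircuitStep N V o o') : CircuitStep N V o' o := by
  obtain ⟨c, hc, hco, rfl⟩ := h
  refine ⟨-c, hc.neg, fun e he => ?_, by simp⟩
  have := hco e (by simpa using he)
  simp only [Pi.neg_apply, Pi.sub_apply, Pi.smul_apply, smul_eq_mul]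
  linarith

theorem CircuitStep.isOrient (h : CircuitStep N V o o') (ho : IsOrient o) : IsOrient o' := by
  obtain ⟨c, -, hco, rfl⟩ := h
  exact ho.sub_two_smul hco

/-- Reversal of a signed circuit or of a signed cocircuit. -/
def Step (N : Matroid E) (V W : Submodule ℝ (E → ℝ)) (o o' : E → ℝ) : Prop :=
  CircuitStep N V o o' ∨ CircuitStep N✶ W o o'

theorem step_dual : Step N✶ W V = Step N V W := by
  funext o o'
  rw [Step, Step, Matroid.dual_dual, or_comm]

theorem isOrient_iff_of_eqvGen (hs : Relation.EqvGen (Step N V W) o o') :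
    IsOrient o ↔ IsOrient o' := by
  induction hs with
  | rel _ _ h =>
    exact h.elim (fun h => ⟨h.isOrient, h.symm.isOrient⟩) fun h => ⟨h.isOrient, h.symm.isOrient⟩
  | refl => rfl
  | symm _ _ _ ih => exact ih.symm
  | trans _ _ _ _ _ ih ih' => exact ih.trans ih'

theorem sub_mem_of_eqvGen {G : Type*} [AddCommGroup G] {H : AddSubgroup G} {r : G → G → Prop}
    (hr : ∀ a b, r a b → a - b ∈ H) {a b : G} (h : Relation.EqvGen r a b) : a - b ∈ H := by
  induction h with
  | rel _ _ h => exact hr _ _ h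
  | refl a => exact sub_self a ▸ H.zero_mem
  | symm a b _ ih => exact neg_sub a b ▸ H.neg_mem ih
  | trans a b c _ _ ih ih' => exact sub_add_sub_cancel a b c ▸ H.add_mem ih ih'

/-- `o` arises from `f` by reversing the sign vectors `c` in `V` and `d` in `W`, which are contained
in `f` and have disjoint supports. -/
structure ReversesTo (V W : Submodule ℝ (E → ℝ)) (f c d o : E → ℝ) : Prop where
  mem_left : c ∈ V
  mem_right : d ∈ W
  left : ContainedIn c f
  right : ContainedIn d f
  disjoint (e : E) : c e = 0 ∨ d e = 0
  eq : o = f - (2 : ℝ) • (c + d)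

theorem ReversesTo.dual {f c d : E → ℝ} (h : ReversesTo V W f c d o) : ReversesTo W V f d c o :=
  ⟨h.mem_right, h.mem_left, h.right, h.left, fun e => (h.disjoint e).symm, add_comm c d ▸ h.eq⟩

/-- The vectors of `V` with even integer entries. -/
def evenVectors (V : Submodule ℝ (E → ℝ)) : AddSubgroup (E → ℝ) :=
  V.toAddSubgroup ⊓ AddSubgroup.pi Set.univ fun _ => AddSubgroup.zmultiples 2

theorem CircuitStep.sub_mem_evenVectors (h : CircuitStep N V o o') : o - o' ∈ evenVectors V := by
  obtain ⟨c, hc, -, rfl⟩ := h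
  rw [sub_sub_cancel]
  refine ⟨V.smul_mem _ hc.mem, fun e _ => AddSubgroup.mem_zmultiples_iff.2 ?_⟩
  rcases hc.sign e with h | h | h
  exacts [⟨0, by simp [h]⟩, ⟨1, by simp [h]⟩, ⟨-1, by simp [h]⟩]

theorem mul_nonpos_of_add_eq_zero_or_two {x y : ℝ} (hx : x ∈ AddSubgroup.zmultiples (2 : ℝ))
    (hxy : x + y = 0 ∨ x + y = 2 ∨ x + y = -2) : x * y ≤ 0 := by
  obtain ⟨n, rfl⟩ := AddSubgroup.mem_zmultiples_iff.1 hx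
  have hint (k : ℤ) (hk : k = 1 ∨ k = -1) : n * (k - n) ≤ 0 := by
    rcases hk with rfl | rfl <;> rcases lt_trichotomy n 0 with h | h | h <;> nlinarith
  have hreal (k : ℤ) (hk : k = 1 ∨ k = -1) : (n : ℝ) * (k - n) ≤ 0 := by exact_mod_cast hint k hk
  have h₁ := hreal 1 (Or.inl rfl)
  have h₂ := hreal (-1) (Or.inr rfl)
  push_cast at h₁ h₂
  rw [zsmul_eq_mul] at hxy ⊢
  rcases hxy with h | h | h <;> rw [eq_sub_of_add_eq' h] <;> nlinarith [mul_self_nonneg (n : ℝ)]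

theorem RegularPair.exists_reversesTo [Fintype E] (h : RegularPair N V W) (ho : IsOrient o)
    (hs : Relation.EqvGen (Step N V W) o o') : ∃ c d, ReversesTo V W o c d o' := by
  have ho' := (isOrient_iff_of_eqvGen hs).1 ho
  have hmem : o - o' ∈ evenVectors V ⊔ evenVectors W := sub_mem_of_eqvGen (fun a b hab => hab.elim
    (fun h => AddSubgroup.mem_sup_left h.sub_mem_evenVectors)
    fun h => AddSubgroup.mem_sup_right h.sub_mem_evenVectors) hs
  obtain ⟨a, ha, b, hb, hab⟩ := AddSubgroup.mem_sup.1 hmem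
  have habe (e : E) : a e + b e = 0 ∨ a e + b e = 2 * o e := by
    have : a e + b e = o e - o' e := congrFun hab e
    rcases ho e with h₁ | h₁ <;> rcases ho' e with h₂ | h₂ <;> rw [this, h₁, h₂] <;> norm_num
  have hmul (e : E) : a e * b e ≤ 0 := mul_nonpos_of_add_eq_zero_or_two (ha.2 e trivial) <|
    (habe e).imp_right fun h => by rcases ho e with h' | h' <;> simp [h, h']
  have hprod (e : E) : a e = 0 ∨ b e = 0 := by
    have hsum : ∑ e, a e * b e = 0 := h.dotProduct_eq_zero ha.1 hb.1
    rw [Finset.sum_eq_zero_iff_of_nonpos fun e _ => hmul e] at hsum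
    exact mul_eq_zero.1 (hsum e (Finset.mem_univ e))
  have hcontained {x y : E → ℝ} (hxy : ∀ e, x e + y e = 0 ∨ x e + y e = 2 * o e)
      (h0 : ∀ e, x e = 0 ∨ y e = 0) : ContainedIn ((2⁻¹ : ℝ) • x) o := fun e he => by
    have hx : x e ≠ 0 := right_ne_zero_of_mul he
    have := hxy e
    rw [(h0 e).resolve_left hx, add_zero] at this
    rw [Pi.smul_apply, this.resolve_left hx, smul_eq_mul, inv_mul_cancel_left₀ two_ne_zero]
  refine ⟨(2⁻¹ : ℝ) • a, (2⁻¹ : ℝ) • b, V.smul_mem _ ha.1, W.smul_mem _ hb.1,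
    hcontained habe hprod, hcontained (fun e => add_comm (a e) (b e) ▸ habe e)
      fun e => (hprod e).symm, fun e => by simpa using hprod e, ?_⟩
  rw [← smul_add, hab, smul_inv_smul₀ two_ne_zero, sub_sub_cancel]

variable [Finite E]

theorem UnimodularSpace.signVector_induction (h : UnimodularSpace N V) {P : (E → ℝ) → Prop}
    (zero : P 0) (add : ∀ u c, SignedCircuitIn N V u → IsSignVector c →
      Disjoint (Function.support u) (Function.support c) → P c → P (u + c))
    {c : E → ℝ} (hc : c ∈ V) (hs : IsSignVector c) : P c := by
  by_cases hc0 : c = 0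
  · exact hc0 ▸ zero
  obtain ⟨u, hu, huc⟩ := h.exists_conforms hc hc0
  have hcont := huc.containedIn hu.sign hs
  have hdisj : Disjoint (Function.support u) (Function.support (c - u)) :=
    Set.disjoint_left.2 fun e he he' => he' (sub_eq_zero.2 (hcont e he).symm)
  have hss : Function.support (c - u) ⊂ Function.support c := by
    obtain ⟨e, he⟩ := Function.ne_iff.1 hu.ne_zero
    refine (Set.ssubset_iff_of_subset fun f hf hcf => ?_).2
      ⟨e, huc.support_subset he, hdisj.notMem_of_mem_left he⟩
    exact hf (by simp [hcf, Function.notMem_support.1 fun h => huc.support_subset h hcf])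
  have hsub : IsSignVector (c - u) := fun e => by
    by_cases he : u e = 0
    · simpa [he] using hs e
    · exact Or.inl (sub_eq_zero.2 (hcont e he).symm)
  rw [← add_sub_cancel u c]
  exact add u (c - u) hu hsub hdisj
    (h.signVector_induction zero add (V.sub_mem hc hu.mem) hsub)
termination_by (Function.support c).ncard
decreasing_by exact Set.ncard_lt_ncard hss (Set.toFinite _)

theorem UnimodularSpace.eqvGen_circuitStep (h : UnimodularSpace N V) {c : E → ℝ} (hc : c ∈ V)
    (hs : IsSignVector c) (hco : ContainedIn c o) :
    Relation.EqvGen (CircuitStep N V) o (o - (2 : ℝ) • c) := by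
  refine h.signVector_induction (P := fun c => ∀ o, ContainedIn c o →
    Relation.EqvGen (CircuitStep N V) o (o - (2 : ℝ) • c))
    (fun o _ => by simpa using Relation.EqvGen.refl o) (fun u c hu _ hdisj ih o hco => ?_) hc hs o
    hco
  have hzero (e : E) : u e = 0 ∨ c e = 0 := by
    by_contra! h
    exact hdisj.notMem_of_mem_left h.1 h.2
  have huo : ContainedIn u o := fun e he => by
    simpa [(hzero e).resolve_left he, he] using hco e
  have hco' : ContainedIn c (o - (2 : ℝ) • u) := fun e he => by
    simpa [(hzero e).resolve_right he, he] using hco e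
  refine (Relation.EqvGen.rel _ _ ⟨u, hu, huo, rfl⟩).trans _ _ _ ?_
  rw [smul_add, ← sub_sub]
  exact ih _ hco'

theorem UnimodularSpace.exists_disjoint_circuits (h : UnimodularSpace N V) {c : E → ℝ}
    (hc : c ∈ V) (hs : IsSignVector c) :
    ∃ 𝒞 : Set (E → ℝ), (∀ v ∈ 𝒞, SignedCircuitIn N V v ∧ ContainedIn v c) ∧
      𝒞.PairwiseDisjoint Function.support ∧ ⋃ v ∈ 𝒞, Function.support v = Function.support c := by
  refine h.signVector_induction (P := fun c => ∃ 𝒞 : Set (E → ℝ),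
    (∀ v ∈ 𝒞, SignedCircuitIn N V v ∧ ContainedIn v c) ∧ 𝒞.PairwiseDisjoint Function.support ∧
      ⋃ v ∈ 𝒞, Function.support v = Function.support c) ⟨∅, by simp⟩
    (fun u c hu _ hdisj ⟨𝒞, h𝒞, hpair, hunion⟩ => ?_) hc hs
  have hzero (e : E) : u e = 0 ∨ c e = 0 := by
    by_contra! h
    exact hdisj.notMem_of_mem_left h.1 h.2
  have huc : ContainedIn u (u + c) := fun e he => by simp [(hzero e).resolve_left he]
  have hcu : ContainedIn c (u + c) := fun e he => by simp [(hzero e).resolve_right he]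
  refine ⟨insert u 𝒞, Set.forall_mem_insert.2 ⟨⟨hu, huc⟩, fun v hv =>
    ⟨(h𝒞 v hv).1, (h𝒞 v hv).2.trans hcu⟩⟩, hpair.insert fun v hv _ => ?_, ?_⟩
  · exact hdisj.mono_right (hunion ▸ Set.subset_biUnion_of_mem hv)
  · rw [Set.biUnion_insert, hunion]
    ext e
    rcases hzero e with h | h <;> simp [h]

end Reversals

section LinearProgram

variable {E : Type*} {N : Matroid E} {V W : Submodule ℝ (E → ℝ)} {o g : E → ℝ}

theorem IsOrient.mul_nonneg_of_mul_nonneg (ho : IsOrient o) {x y : E → ℝ} {e : E}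
    (hx : 0 ≤ o e * x e) (hy : 0 ≤ o e * y e) : 0 ≤ x e * y e := by
  rcases ho e with h | h <;> rw [h] at hx hy <;> nlinarith

theorem IsOrient.containedIn (ho : IsOrient o) {c : E → ℝ} (hc : IsSignVector c)
    (hoc : ∀ e, 0 ≤ o e * c e) : ContainedIn c o := fun e he => by
  have hpos := hoc e
  rcases (hc e).resolve_left he with h₁ | h₁ <;> rcases ho e with h₂ | h₂ <;>
    rw [h₁, h₂] at hpos ⊢ <;> norm_num at hpos

theorem Conforms.mul_nonneg {c v : E → ℝ} (h : Conforms c v) {e : E} (hv : 0 ≤ o e * v e) :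
    0 ≤ o e * c e := by
  by_cases he : c e = 0
  · simp [he]
  · have hcv := h e he
    nlinarith [_root_.mul_nonneg hv hcv.le, mul_self_pos.2 (right_ne_zero_of_mul hcv.ne')]

variable [Fintype E]

theorem exists_forall_dotProduct_ne_zero {S : Set (E → ℝ)} (hS : S.Finite) (h0 : 0 ∉ S) :
    ∃ g : E → ℝ, ∀ v ∈ S, v ⬝ᵥ g ≠ 0 := by
  classical
  let K (v : E → ℝ) : Submodule ℝ (E → ℝ) := LinearMap.ker (dotProductBilin ℝ ℝ v)
  have htop : ⊤ ∉ hS.toFinset.image K := fun h => by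
    obtain ⟨v, hv, hvt⟩ := Finset.mem_image.1 h
    have hvv : v ∈ K v := hvt ▸ Submodule.mem_top
    exact h0 (dotProduct_self_eq_zero.1 hvv ▸ hS.mem_toFinset.1 hv)
  obtain ⟨g, hg⟩ := (Set.ne_univ_iff_exists_notMem _).1
    (Subspace.biUnion_ne_univ_of_top_notMem htop)
  refine ⟨g, fun v hv h => hg ?_⟩
  exact Set.mem_biUnion (Finset.mem_image_of_mem K (hS.mem_toFinset.2 hv)) h

theorem UnimodularSpace.dotProduct_nonneg (h : UnimodularSpace N V) (ho : IsOrient o)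
    (hC : ∀ c, SignedCircuitIn N V c → ContainedIn c o → 0 ≤ c ⬝ᵥ g) {z : E → ℝ} (hz : z ∈ V)
    (hoz : ∀ e, 0 ≤ o e * z e) : 0 ≤ z ⬝ᵥ g := by
  by_cases hz0 : z = 0
  · simp [hz0]
  obtain ⟨c, hc, hcz⟩ := h.exists_conforms hz hz0
  obtain ⟨e, he⟩ := Function.ne_iff.1 hc.ne_zero
  obtain ⟨t, ht, hconf, hss⟩ := exists_conforms_sub_smul hcz.support_subset ⟨e, hcz e he⟩
  have hco := ho.containedIn hc.sign fun e => hcz.mul_nonneg (hoz e)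
  have hrest := h.dotProduct_nonneg ho hC (V.sub_mem hz (V.smul_mem t hc.mem))
    fun e => hconf.mul_nonneg (hoz e)
  rw [sub_dotProduct, smul_dotProduct, smul_eq_mul, sub_nonneg] at hrest
  exact (mul_nonneg ht.le (hC c hc hco)).trans hrest
termination_by (Function.support z).ncard
decreasing_by exact Set.ncard_lt_ncard hss (Set.toFinite _)

theorem exists_multipliers (h : ∀ k ∈ V, ∀ r ∈ W, ∀ t : ℝ, (∀ e, 0 ≤ o e * (k + t • g) e) →
      (∀ e, 0 ≤ o e * (r + t • g) e) → g ⬝ᵥ (k + r + t • g) ≤ 0 → t ≤ 0) :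
    ∃ (σ : ℝ) (a b : E → ℝ), 0 ≤ σ ∧ (∀ e, 0 ≤ a e) ∧ (∀ e, 0 ≤ b e) ∧
      ∀ k ∈ V, ∀ r ∈ W, ∀ t : ℝ, (a * o) ⬝ᵥ (k + t • g) + (b * o) ⬝ᵥ (r + t • g) + t =
        σ * g ⬝ᵥ (k + r + t • g) := by
  let pV : (V × W × ℝ) →ₗ[ℝ] (E → ℝ) := V.subtype ∘ₗ LinearMap.fst ℝ _ _
  let pW : (V × W × ℝ) →ₗ[ℝ] (E → ℝ) := W.subtype ∘ₗ LinearMap.fst ℝ _ _ ∘ₗ LinearMap.snd ℝ _ _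
  let pt : (V × W × ℝ) →ₗ[ℝ] ℝ := LinearMap.snd ℝ _ _ ∘ₗ LinearMap.snd ℝ _ _
  let L : Option (E ⊕ E) → Module.Dual ℝ (V × W × ℝ) := fun i =>
    i.elim (-(dotProductBilin ℝ ℝ g ∘ₗ (pV + pW + pt.smulRight g))) <| Sum.elim
      (fun e => o e • (LinearMap.proj e ∘ₗ (pV + pt.smulRight g)))
      fun e => o e • (LinearMap.proj e ∘ₗ (pW + pt.smulRight g))
  obtain ⟨c, hc, hcL⟩ := farkas (a := L) (b := -pt) fun ⟨k, r, t⟩ hL =>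
    neg_nonneg.2 <| h k k.2 r r.2 t (fun e => hL (some (Sum.inl e)))
      (fun e => hL (some (Sum.inr e))) (neg_nonneg.1 (hL none))
  refine ⟨c none, fun e => c (some (Sum.inl e)), fun e => c (some (Sum.inr e)), hc _,
    fun e => hc _, fun e => hc _, fun k hk r hr t => ?_⟩
  have hid := hcL (⟨k, hk⟩, ⟨r, hr⟩, t)
  rw [Fintype.sum_option, Fintype.sum_sum_type] at hid
  change -t = c none * -(g ⬝ᵥ (k + r + t • g)) +
    (∑ e, c (some (Sum.inl e)) * (o e * (k + t • g) e) +
      ∑ e, c (some (Sum.inr e)) * (o e * (r + t • g) e)) at hid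
  simp only [dotProduct, Pi.mul_apply, mul_assoc] at hid ⊢
  linarith

theorem RegularPair.exists_homogeneous_optimal (h : RegularPair N V W) (ho : IsOrient o)
    (hC : ∀ c, SignedCircuitIn N V c → ContainedIn c o → 0 ≤ c ⬝ᵥ g)
    (hD : ∀ d, SignedCircuitIn N✶ W d → ContainedIn d o → 0 ≤ d ⬝ᵥ g) :
    ∃ k ∈ V, ∃ r ∈ W, ∃ t : ℝ, 0 < t ∧ (∀ e, 0 ≤ o e * (k + t • g) e) ∧
      (∀ e, 0 ≤ o e * (r + t • g) e) ∧ g ⬝ᵥ (k + r + t • g) ≤ 0 := by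
  by_contra! hno
  obtain ⟨σ, a, b, hσ, ha, hb, hid⟩ := exists_multipliers fun k hk r hr t hx hy hs =>
    not_lt.1 fun ht => (hno k hk r hr t ht hx hy).not_ge hs
  have hconf {c : E → ℝ} (hc : ∀ e, 0 ≤ c e) (e : E) : 0 ≤ o e * (c * o) e := by
    rw [Pi.mul_apply, mul_left_comm, ho.mul_self, mul_one]
    exact hc e
  have haW : a * o - σ • g ∈ W := (h.mem_right _).2 fun v hv => by
    have := hid v hv 0 W.zero_mem 0
    simp only [zero_smul, add_zero, dotProduct_zero] at this
    rw [sub_dotProduct, this, smul_dotProduct, smul_eq_mul, sub_self]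
  have hbV : b * o - σ • g ∈ V := (h.mem_left _).2 fun w hw => by
    have := hid 0 V.zero_mem w hw 0
    simp only [zero_smul, add_zero, zero_add, dotProduct_zero] at this
    rw [sub_dotProduct, this, smul_dotProduct, smul_eq_mul, sub_self]
  have hone := hid 0 V.zero_mem 0 W.zero_mem 1
  simp only [one_smul, zero_add] at hone
  have hσ0 : σ = 0 := by
    have horth := h.dotProduct_eq_zero hbV haW
    have hab : 0 ≤ (b * o) ⬝ᵥ (a * o) := Finset.sum_nonneg fun e _ =>
      ho.mul_nonneg_of_mul_nonneg (hconf hb e) (hconf ha e)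
    simp only [sub_dotProduct, dotProduct_sub, smul_dotProduct, dotProduct_smul, smul_eq_mul,
      dotProduct_comm g (a * o)] at horth
    nlinarith
  simp only [hσ0, zero_smul, sub_zero, zero_mul] at haW hbV hone
  linarith [h.right.dotProduct_nonneg ho hD haW (hconf ha),
    h.left.dotProduct_nonneg ho hC hbV (hconf hb)]

theorem RegularPair.exists_optimal (h : RegularPair N V W) (ho : IsOrient o)
    (hC : ∀ c, SignedCircuitIn N V c → ContainedIn c o → 0 ≤ c ⬝ᵥ g)
    (hD : ∀ d, SignedCircuitIn N✶ W d → ContainedIn d o → 0 ≤ d ⬝ᵥ g) :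
    ∃ x y, x - g ∈ V ∧ y - g ∈ W ∧ (∀ e, 0 ≤ o e * x e) ∧ (∀ e, 0 ≤ o e * y e) ∧
      ∀ e, x e = 0 ∨ y e = 0 := by
  obtain ⟨k, hk, r, hr, t, ht, hok, hor, hle⟩ := h.exists_homogeneous_optimal ho hC hD
  have hsub (z : E → ℝ) : t⁻¹ • (z + t • g) - g = t⁻¹ • z := by
    rw [smul_add, inv_smul_smul₀ ht.ne', add_sub_cancel_right]
  have hscale {z : E → ℝ} (hz : ∀ e, 0 ≤ o e * (z + t • g) e) (e : E) :
      0 ≤ o e * (t⁻¹ • (z + t • g)) e := by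
    rw [Pi.smul_apply, smul_eq_mul, mul_left_comm]
    exact mul_nonneg (inv_nonneg.2 ht.le) (hz e)
  have hnonneg (e : E) : 0 ≤ (k + t • g) e * (r + t • g) e :=
    ho.mul_nonneg_of_mul_nonneg (hok e) (hor e)
  have hsum : (k + t • g) ⬝ᵥ (r + t • g) ≤ 0 := by
    have : (k + t • g) ⬝ᵥ (r + t • g) = t * g ⬝ᵥ (k + r + t • g) := by
      simp only [add_dotProduct, dotProduct_add, smul_dotProduct, dotProduct_smul, smul_eq_mul,
        h.dotProduct_eq_zero hk hr, dotProduct_comm g k]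
      ring
    exact this ▸ mul_nonpos_of_nonneg_of_nonpos ht.le hle
  have hzero := hsum.antisymm (Finset.sum_nonneg fun e _ => hnonneg e)
  refine ⟨t⁻¹ • (k + t • g), t⁻¹ • (r + t • g), hsub k ▸ V.smul_mem _ hk,
    hsub r ▸ W.smul_mem _ hr, hscale hok, hscale hor, fun e => ?_⟩
  have hprod := (Finset.sum_eq_zero_iff_of_nonneg fun e _ => hnonneg e).1 hzero e
    (Finset.mem_univ e)
  exact (mul_eq_zero.1 hprod).imp (fun h => by simp [Pi.smul_apply, h])
    fun h => by simp [Pi.smul_apply, h]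

end LinearProgram

section OptimalBases

variable {E : Type*} {N : Matroid E} {V W : Submodule ℝ (E → ℝ)} {o o' g : E → ℝ} {B : Set E}

/-- `x` and `y` are complementary solutions, supported on `B` and on the complement of `B`, of the
dual pair of linear programs given by the weight `g` and the sign pattern `o`. -/
def IsOptimalBasis (V W : Submodule ℝ (E → ℝ)) (g o : E → ℝ) (B : Set E) : Prop :=
  ∃ x y, x - g ∈ V ∧ y - g ∈ W ∧ (∀ e, 0 ≤ o e * x e) ∧ (∀ e, 0 ≤ o e * y e) ∧
    Function.support x = B ∧ Function.support y = Bᶜ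

theorem UnimodularSpace.eq_of_support_subset (h : UnimodularSpace N V) (hB : N.Indep B)
    {x x' : E → ℝ} (hx : x - g ∈ V) (hx' : x' - g ∈ V) (hxB : Function.support x ⊆ B)
    (hxB' : Function.support x' ⊆ B) : x = x' := by
  have hmem : x - x' ∈ V := sub_sub_sub_cancel_right x x' g ▸ V.sub_mem hx hx'
  exact sub_eq_zero.1 <| (h.indep_iff B).1 hB _ hmem <|
    (Function.support_sub x x').trans (Set.union_subset hxB hxB')

theorem IsOrient.eq_of_mul_nonneg (ho : IsOrient o) (ho' : IsOrient o') {e : E} {z : ℝ}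
    (hz : z ≠ 0) (h : 0 ≤ o e * z) (h' : 0 ≤ o' e * z) : o e = o' e := by
  rcases ho e with h₁ | h₁ <;> rcases ho' e with h₂ | h₂ <;> rw [h₁] at h ⊢ <;> rw [h₂] at h' ⊢ <;>
    exact absurd (by linarith) hz

variable [Fintype E]

theorem IsOptimalBasis.unique (h : RegularPair N V W) (hB : N.IsBase B) (ho : IsOrient o)
    (ho' : IsOrient o') (hopt : IsOptimalBasis V W g o B) (hopt' : IsOptimalBasis V W g o' B) :
    o = o' := by
  obtain ⟨x, y, hx, hy, hox, hoy, hxB, hyB⟩ := hopt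
  obtain ⟨x', y', hx', hy', hox', hoy', hxB', hyB'⟩ := hopt'
  obtain rfl := h.left.eq_of_support_subset hB.indep hx hx' hxB.le hxB'.le
  obtain rfl := h.right.eq_of_support_subset (h.left.indep_compl hB) hy hy' hyB.le hyB'.le
  ext e
  by_cases he : e ∈ B
  · exact ho.eq_of_mul_nonneg ho' (hxB.ge he) (hox e) (hox' e)
  · exact ho.eq_of_mul_nonneg ho' (hyB.ge he) (hoy e) (hoy' e)

theorem RegularPair.indep_compl_support (h : RegularPair N V W)
    (hg : ∀ v, IsSignVector v → v ≠ 0 → v ⬝ᵥ g ≠ 0) {y : E → ℝ} (hy : y - g ∈ W) :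
    N.Indep (Function.support y)ᶜ := by
  rw [h.left.indep_iff]
  intro v hv hvy
  by_contra hv0
  obtain ⟨c, hc, hcv⟩ := h.left.exists_conforms hv hv0
  have hcy : c ⬝ᵥ y = 0 := Finset.sum_eq_zero fun e _ => by
    by_cases hce : c e = 0
    · rw [hce, zero_mul]
    · rw [Function.notMem_support.1 (hvy (hcv.support_subset hce)), mul_zero]
  refine hg c hc.sign hc.ne_zero ?_
  rw [← sub_sub_cancel y g, dotProduct_sub, hcy, h.dotProduct_eq_zero hc.mem hy, sub_zero]

theorem RegularPair.exists_isOptimalBasis (h : RegularPair N V W)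
    (hg : ∀ v, IsSignVector v → v ≠ 0 → v ⬝ᵥ g ≠ 0) (ho : IsOrient o)
    (hC : ∀ c, SignedCircuitIn N V c → ContainedIn c o → 0 ≤ c ⬝ᵥ g)
    (hD : ∀ d, SignedCircuitIn N✶ W d → ContainedIn d o → 0 ≤ d ⬝ᵥ g) :
    ∃ B : Base N, IsOptimalBasis V W g o B.1 := by
  obtain ⟨x, y, hx, hy, hox, hoy, hxy⟩ := h.exists_optimal ho hC hD
  have hsub : Function.support x ⊆ (Function.support y)ᶜ := fun e he hey => (hxy e).elim he hey
  have hindep := h.indep_compl_support hg hy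
  have hspan : N.Spanning (Function.support x) := by
    rw [Matroid.spanning_iff_compl_coindep (by simp [h.left.ground]), h.left.ground,
      ← Set.compl_eq_univ_sdiff]
    exact h.dual.indep_compl_support hg hx
  have hB : N.IsBase (Function.support x) := (hindep.subset hsub).isBase_of_spanning hspan
  refine ⟨⟨_, hB⟩, x, y, hx, hy, hox, hoy, rfl, ?_⟩
  exact compl_eq_comm.1 (hB.eq_of_subset_indep hindep hsub).symm |>.symm

theorem finite_isSignVector {E : Type*} [Finite E] : {v : E → ℝ | IsSignVector v}.Finite := by
  refine (Set.Finite.pi' (t := fun _ : E => ({0, 1, -1} : Set ℝ)) fun _ => by simp).subset ?_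
  exact fun v hv e => by simpa using hv e

-- An orientation of maximal weight in its class has no improving reversal.
theorem RegularPair.exists_eqvGen_isOptimalBasis (h : RegularPair N V W)
    (hg : ∀ v, IsSignVector v → v ≠ 0 → v ⬝ᵥ g ≠ 0) (ho : IsOrient o) :
    ∃ (B : Base N) (o₁ : E → ℝ), Relation.EqvGen (Step N V W) o o₁ ∧
      IsOptimalBasis V W g o₁ B.1 := by
  obtain ⟨o₁, hoo₁, hmax⟩ := Set.exists_max_image
    {o' | Relation.EqvGen (Step N V W) o o'} (fun o' => o' ⬝ᵥ g)
    (finite_isSignVector.subset fun _ ho' => ((isOrient_iff_of_eqvGen ho').1 ho).isSignVector)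
    ⟨o, Relation.EqvGen.refl o⟩
  have hstep {c : E → ℝ} (hc : Step N V W o₁ (o₁ - (2 : ℝ) • c)) : 0 ≤ c ⬝ᵥ g := by
    have := hmax _ (hoo₁.trans _ _ _ (Relation.EqvGen.rel _ _ hc))
    rw [sub_dotProduct, smul_dotProduct, smul_eq_mul] at this
    linarith
  obtain ⟨B, hB⟩ := h.exists_isOptimalBasis hg ((isOrient_iff_of_eqvGen hoo₁).1 ho)
    (fun c hc hco => hstep (Or.inl ⟨c, hc, hco, rfl⟩))
    fun c hc hco => hstep (Or.inr ⟨c, hc, hco, rfl⟩)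
  exact ⟨B, o₁, hoo₁, hB⟩

-- Since a basis is optimal for at most one class, there are at most as many classes as bases.
theorem RegularPair.exists_eqvGen_of_inequivalent (h : RegularPair N V W) {f : Base N → E → ℝ}
    (hf : ∀ B, IsOrient (f B))
    (hne : ∀ B B', Relation.EqvGen (Step N V W) (f B) (f B') → B = B') (ho : IsOrient o) :
    ∃ B, Relation.EqvGen (Step N V W) (f B) o := by
  obtain ⟨g, hg⟩ := exists_forall_dotProduct_ne_zero
    (finite_isSignVector (E := E).subset Set.sdiff_subset) fun h => h.2 (Set.mem_singleton 0)
  replace hg (v : E → ℝ) (hv : IsSignVector v) (hv0 : v ≠ 0) : v ⬝ᵥ g ≠ 0 := hg v ⟨hv, hv0⟩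
  have eqvGen_of_eq {o o' o₁ o₁' : E → ℝ} {B : Base N} (ho : IsOrient o) (ho' : IsOrient o')
      (hs : Relation.EqvGen (Step N V W) o o₁) (hs' : Relation.EqvGen (Step N V W) o' o₁')
      (hB : IsOptimalBasis V W g o₁ B.1) (hB' : IsOptimalBasis V W g o₁' B.1) :
      Relation.EqvGen (Step N V W) o o' := by
    obtain rfl := IsOptimalBasis.unique h B.2 ((isOrient_iff_of_eqvGen hs).1 ho)
      ((isOrient_iff_of_eqvGen hs').1 ho') hB hB'
    exact hs.trans _ _ _ (hs'.symm _ _)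
  choose β p hp hβ using fun B => h.exists_eqvGen_isOptimalBasis hg (hf B)
  have hinj : Function.Injective β := fun B B' hBB' =>
    hne B B' (eqvGen_of_eq (hf B) (hf B') (hp B) (hp B') (hβ B) (hBB' ▸ hβ B'))
  obtain ⟨B₀, o₁, hoo₁, hB₀⟩ := h.exists_eqvGen_isOptimalBasis hg ho
  obtain ⟨B, rfl⟩ := Finite.injective_iff_surjective.1 hinj B₀
  exact ⟨B, eqvGen_of_eq (hf B) ho (hp B) hoo₁ (hβ B) hB₀⟩

end OptimalBases

section Separation

variable {E : Type*} {N : Matroid E} {V W : Submodule ℝ (E → ℝ)} {B₁ B₂ : Set E}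
  {f₁ f₂ v : E → ℝ} {e : E}

/-- The arc of `v` at `e` is missing from `F₁ ∩ -F₂`, where `F₁` and `F₂` are the fourientations
that are bioriented on `X₁` and `X₂` and agree elsewhere with the orientations `f₁` and `f₂`. -/
def Misses (X₁ : Set E) (f₁ : E → ℝ) (X₂ : Set E) (f₂ v : E → ℝ) (e : E) : Prop :=
  (e ∉ X₁ ∧ f₁ e * v e < 0) ∨ (e ∉ X₂ ∧ 0 < f₂ e * v e)

theorem Misses.ne_zero (h : Misses B₁ f₁ B₂ f₂ v e) : v e ≠ 0 := by
  rcases h with ⟨-, h⟩ | ⟨-, h⟩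
  exacts [right_ne_zero_of_mul h.ne, right_ne_zero_of_mul h.ne']

open Classical in
theorem misses_iff (hf₁ : IsOrient f₁) (hf₂ : IsOrient f₂) (hB : ¬ (e ∈ B₁ ∧ e ∈ B₂))
    (hf : ¬ (e ∉ B₁ ∧ e ∉ B₂ ∧ f₁ e = f₂ e)) :
    Misses B₁ f₁ B₂ f₂ v e ↔ (if e ∈ B₁ then -f₂ e else f₁ e) * v e < 0 := by
  by_cases h₁ : e ∈ B₁
  · have h₂ : e ∉ B₂ := fun h₂ => hB ⟨h₁, h₂⟩
    simp [Misses, h₁, h₂]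
  by_cases h₂ : e ∈ B₂
  · simp [Misses, h₁, h₂]
  have : f₂ e = -f₁ e := by
    rcases hf₁ e with h | h <;> rcases hf₂ e with h' | h' <;> simp_all
  simp [Misses, h₁, h₂, this]

-- Farkas' lemma applied to the signs which the arcs missing from `F₁ ∩ -F₂` prescribe.
theorem RegularPair.exists_separating_unscaled [Fintype E] (h : RegularPair N V W)
    (hf₁ : IsOrient f₁) (hf₂ : IsOrient f₂)
    (hmiss : ∀ v, SignedCircuitIn N V v → ∃ e, Misses B₁ f₁ B₂ f₂ v e) :
    ∃ w ∈ W, (∀ e, w e ≠ 0 → Misses B₁ f₁ B₂ f₂ (-w) e) ∧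
      ∀ e, w e = 0 → e ∈ B₁ ∧ e ∈ B₂ ∨ e ∉ B₁ ∧ e ∉ B₂ ∧ f₁ e = f₂ e := by
  classical
  let Z : Set E := {e | e ∉ B₁ ∧ e ∉ B₂ ∧ f₁ e = f₂ e}
  let P : Set E := {e | ¬ (e ∈ B₁ ∧ e ∈ B₂) ∧ e ∉ Z}
  let s : E → ℝ := fun e => if e ∈ B₁ then -f₂ e else f₁ e
  have hs (e) (he : e ∈ P) (v : E → ℝ) : Misses B₁ f₁ B₂ f₂ v e ↔ s e * v e < 0 :=
    misses_iff hf₁ hf₂ he.1 he.2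
  have hs0 (e) (_ : e ∈ P) : s e ≠ 0 := by
    simp only [s]
    split_ifs
    exacts [neg_ne_zero.2 (hf₂.ne_zero e), hf₁.ne_zero e]
  obtain ⟨w, hw, hP, h0⟩ := exists_pos_of_orthogonal (fun w => (h.mem_right w).2)
    (Set.disjoint_left.2 fun _ he => he.2) hs0 fun v hv hZ hP => by
      suffices v = 0 by simp [this]
      by_contra hv0
      obtain ⟨c, hc, hcv⟩ := h.left.exists_conforms hv hv0
      obtain ⟨e, he⟩ := hmiss c hc
      have hcve := hcv e he.ne_zero
      have heP : e ∈ P := by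
        refine ⟨fun hB => he.elim (fun he => he.1 hB.1) fun he => he.1 hB.2, fun heZ => ?_⟩
        exact right_ne_zero_of_mul hcve.ne' (hZ e heZ)
      nlinarith [hP e heP, (hs e heP c).1 he, mul_self_pos.2 (hs0 e heP)]
  refine ⟨w, hw, fun e he => ?_, fun e he => ?_⟩
  · by_cases hB : e ∈ B₁ ∧ e ∈ B₂
    · exact absurd (h0 e (fun heP => heP.1 hB) fun heZ => heZ.1 hB.1) he
    by_cases heZ : e ∈ Z
    · have hf : f₁ e * (-w) e ≠ 0 := mul_ne_zero (hf₁.ne_zero e) (neg_ne_zero.2 he)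
      exact hf.lt_or_gt.imp (fun hlt => ⟨heZ.1, hlt⟩) fun hgt => ⟨heZ.2.1, heZ.2.2 ▸ hgt⟩
    · rw [hs e ⟨hB, heZ⟩, Pi.neg_apply, mul_neg, neg_lt_zero]
      exact hP e ⟨hB, heZ⟩
  · have heP : e ∉ P := fun heP => right_ne_zero_of_mul (hP e heP).ne' he
    exact or_iff_not_and_not.2 heP

theorem Misses.smul (h : Misses B₁ f₁ B₂ f₂ v e) {t : ℝ} (ht : 0 < t) :
    Misses B₁ f₁ B₂ f₂ (t • v) e := by
  simp only [Misses, Pi.smul_apply, smul_eq_mul, mul_left_comm _ t]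
  exact h.imp (And.imp_right (mul_neg_of_pos_of_neg ht)) (And.imp_right (mul_pos ht))

theorem exists_pos_abs_mul_le_one [Finite E] (v : E → ℝ) : ∃ t : ℝ, 0 < t ∧ ∀ e, |t * v e| ≤ 1 := by
  obtain ⟨b, hb⟩ := (Set.finite_range fun e => |v e|).bddAbove
  have hb' : 0 < max b 1 := lt_max_of_lt_right one_pos
  refine ⟨(max b 1)⁻¹, inv_pos.2 hb', fun e => ?_⟩
  rw [abs_mul, abs_of_pos (inv_pos.2 hb'), inv_mul_le_one₀ hb']
  exact (hb ⟨e, rfl⟩).trans (le_max_left b 1)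

theorem RegularPair.exists_separating [Fintype E] (h : RegularPair N V W)
    (hf₁ : IsOrient f₁) (hf₂ : IsOrient f₂)
    (hmiss : ∀ v, SignedCircuitIn N V v → ∃ e, Misses B₁ f₁ B₂ f₂ v e) :
    ∃ w ∈ W, (∀ e, |w e| ≤ 1) ∧ (∀ e, w e ≠ 0 → Misses B₁ f₁ B₂ f₂ (-w) e) ∧
      ∀ e, w e = 0 → e ∈ B₁ ∧ e ∈ B₂ ∨ e ∉ B₁ ∧ e ∉ B₂ ∧ f₁ e = f₂ e := by
  obtain ⟨w, hw, hne, h0⟩ := h.exists_separating_unscaled hf₁ hf₂ hmiss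
  obtain ⟨t, ht, hle⟩ := exists_pos_abs_mul_le_one w
  refine ⟨t • w, W.smul_mem t hw, hle, fun e he => ?_, fun e he => ?_⟩
  · exact smul_neg t w ▸ (hne e (right_ne_zero_of_mul he)).smul ht
  · exact h0 e ((mul_eq_zero.1 he).resolve_left ht.ne')

end Separation

section Tiling

variable {E : Type*} {N : Matroid E} {V W : Submodule ℝ (E → ℝ)} {B B₁ B₂ : Set E}
  {f f₁ f₂ c c₁ c₂ d d₁ d₂ o o₁ o₂ : E → ℝ} {e : E}

theorem ReversesTo.cases (h : ReversesTo V W f c d o) (e : E) :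
    (c e = 0 ∧ d e = 0 ∧ o e = f e) ∨ (c e = f e ∧ d e = 0 ∧ o e = -f e) ∨
      (c e = 0 ∧ d e = f e ∧ o e = -f e) := by
  have ho : o e = f e - 2 * (c e + d e) := congrFun h.eq e
  by_cases hc : c e = 0
  · by_cases hd : d e = 0
    · exact Or.inl ⟨hc, hd, by rw [ho, hc, hd]; ring⟩
    · exact Or.inr (Or.inr ⟨hc, h.right e hd, by rw [ho, hc, h.right e hd]; ring⟩)
  · have hd := (h.disjoint e).resolve_left hc
    exact Or.inr (Or.inl ⟨h.left e hc, hd, by rw [ho, hd, h.left e hc]; ring⟩)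

/-- The set of edges assigned to the basis `B` and the reversal of `c` and `d`. -/
def tileSet (B : Set E) (c d : E → ℝ) : Set E :=
  (B ∪ Function.support c) \ Function.support d

theorem mem_tileSet : e ∈ tileSet B c d ↔ (e ∈ B ∨ c e ≠ 0) ∧ d e = 0 := by
  simp [tileSet]

theorem ReversesTo.tileSet_compl (h : ReversesTo V W f c d o) :
    tileSet Bᶜ d c = (tileSet B c d)ᶜ := by
  ext e
  have := h.disjoint e
  simp only [mem_tileSet, Set.mem_compl_iff]
  tauto

theorem ReversesTo.mul_sub_pos_of_misses (r₁ : ReversesTo V W f₁ c₁ d₁ o₁)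
    (r₂ : ReversesTo V W f₂ c₂ d₂ o₂) (hf₁ : IsOrient f₁) (hf₂ : IsOrient f₂)
    (ht : o₁ e ≠ o₂ e → (e ∈ tileSet B₁ c₁ d₁ ↔ e ∈ tileSet B₂ c₂ d₂)) (hc : c₁ e = c₂ e)
    (hd : d₁ e ≠ d₂ e) {v : E → ℝ} (hv : Misses B₁ᶜ f₁ B₂ᶜ f₂ v e) : 0 < v e * (d₂ e - d₁ e) := by
  have hδ : (e ∈ B₁ → d₂ e - d₁ e = -f₁ e ∨ d₂ e - d₁ e = -2 * f₁ e) ∧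
      (e ∈ B₂ → d₂ e - d₁ e = f₂ e ∨ d₂ e - d₁ e = 2 * f₂ e) := by
    simp only [mem_tileSet] at ht
    have := r₁.cases e
    have := r₂.cases e
    have := hf₁ e
    have := hf₂ e
    grind
  rcases hv with ⟨hB, hv⟩ | ⟨hB, hv⟩
  · rcases hδ.1 (not_not.1 hB) with h | h <;> rw [h] <;> linarith
  · rcases hδ.2 (not_not.1 hB) with h | h <;> rw [h] <;> linarith

theorem ReversesTo.sub_eq_sub_of_ne (r₁ : ReversesTo V W f₁ c₁ d₁ o₁)
    (r₂ : ReversesTo V W f₂ c₂ d₂ o₂) (hf₁ : IsOrient f₁) (hf₂ : IsOrient f₂)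
    (ht : o₁ e ≠ o₂ e → (e ∈ tileSet B₁ c₁ d₁ ↔ e ∈ tileSet B₂ c₂ d₂)) (hc : c₁ e ≠ c₂ e)
    (hd : d₁ e ≠ d₂ e) : c₁ e - c₂ e = d₂ e - d₁ e := by
  simp only [mem_tileSet] at ht
  have := r₁.cases e
  have := r₂.cases e
  have := hf₁ e
  have := hf₂ e
  grind

theorem ReversesTo.eq_of_sub_eq_zero (r₁ : ReversesTo V W f₁ c₁ d₁ o₁)
    (r₂ : ReversesTo V W f₂ c₂ d₂ o₂) (hf₁ : IsOrient f₁) (hf₂ : IsOrient f₂)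
    (ht : o₁ e ≠ o₂ e → (e ∈ tileSet B₁ c₁ d₁ ↔ e ∈ tileSet B₂ c₂ d₂)) (hc : c₁ e = c₂ e)
    (hd : d₁ e = d₂ e) (hB : ¬ (e ∈ B₁ ↔ e ∈ B₂)) : f₁ e = f₂ e := by
  simp only [mem_tileSet] at ht
  have := r₁.cases e
  have := r₂.cases e
  have := hf₁ e
  have := hf₂ e
  grind

theorem Misses.mul_pos (hf : ¬ (e ∈ B₁ ↔ e ∈ B₂) → f₁ e = f₂ e) {v w : E → ℝ}
    (hv : Misses B₁ᶜ f₁ B₂ᶜ f₂ v e) (hw : Misses B₁ f₁ B₂ f₂ (-w) e) (hf₁ : IsOrient f₁) :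
    0 < v e * w e := by
  have hvw : 0 < f₁ e * v e * (f₁ e * w e) := by
    simp only [Misses, Set.notMem_compl_iff, Pi.neg_apply, mul_neg, neg_lt_zero, neg_pos] at hv hw
    rcases hv with ⟨h₁, hv⟩ | ⟨h₂, hv⟩
    · obtain ⟨h₂, hw⟩ := hw.resolve_left fun hw => hw.1 h₁
      rw [← hf (by tauto)] at hw
      exact mul_pos_of_neg_of_neg hv hw
    · obtain ⟨h₁, hw⟩ := hw.resolve_right fun hw => hw.1 h₂
      rw [← hf (by tauto)] at hv
      exact _root_.mul_pos hv hw
  rwa [mul_mul_mul_comm, hf₁.mul_self, one_mul] at hvw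

theorem IsSignVector.one_le_abs_sub {u v : E → ℝ} (hu : IsSignVector u) (hv : IsSignVector v)
    (h : u e ≠ v e) : 1 ≤ |u e - v e| := by
  rcases hu e with hu | hu | hu <;> rcases hv e with hv | hv | hv <;> rw [hu, hv] at h ⊢ <;>
    first | exact absurd rfl h | norm_num

theorem IsSignVector.abs_le_one {v : E → ℝ} (hv : IsSignVector v) : |v e| ≤ 1 := by
  rcases hv e with h | h | h <;> simp [h]

theorem mul_add_two_mul_pos {x y z : ℝ} (hxz : 0 < x * z) (hy : |y| ≤ 1) (hz : 1 ≤ |z|) :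
    0 < x * (y + 2 * z) := by
  have hx : 0 < |x| := abs_pos.2 (left_ne_zero_of_mul hxz.ne')
  have hxy := (neg_abs_le (x * y)).trans' (neg_le_neg (abs_mul x y).le)
  have := abs_mul x z ▸ abs_of_pos hxz
  nlinarith

theorem ReversesTo.mul_pos_or_mem (r₁ : ReversesTo V W f₁ c₁ d₁ o₁)
    (r₂ : ReversesTo V W f₂ c₂ d₂ o₂) (hf₁ : IsOrient f₁) (hf₂ : IsOrient f₂)
    (ht : o₁ e ≠ o₂ e → (e ∈ tileSet B₁ c₁ d₁ ↔ e ∈ tileSet B₂ c₂ d₂)) {v w : E → ℝ}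
    (hv : |v e| ≤ 1) (hvm : v e ≠ 0 → Misses B₁ᶜ f₁ B₂ᶜ f₂ v e) (hw : |w e| ≤ 1)
    (hwm : w e ≠ 0 → Misses B₁ f₁ B₂ f₂ (-w) e)
    (hw0 : w e = 0 → e ∈ B₁ ∧ e ∈ B₂ ∨ e ∉ B₁ ∧ e ∉ B₂ ∧ f₁ e = f₂ e) :
    0 < (v e + 2 * (c₁ e - c₂ e)) * (w e + 2 * (d₂ e - d₁ e)) ∨
      (v e + 2 * (c₁ e - c₂ e)) * (w e + 2 * (d₂ e - d₁ e)) = 0 ∧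
        (v e ≠ 0 → e ∈ B₁ ∧ e ∈ B₂) := by
  have hmem (hw : w e = 0) (hv : v e ≠ 0) : e ∈ B₁ ∧ e ∈ B₂ := by
    refine (hw0 hw).resolve_right fun hB => ?_
    exact (hvm hv).elim (fun h => h.1 hB.1) fun h => h.1 hB.2.1
  have hk (hc : c₁ e ≠ c₂ e) : 1 ≤ |c₁ e - c₂ e| :=
    (r₁.left.isSignVector hf₁.isSignVector).one_le_abs_sub
      (r₂.left.isSignVector hf₂.isSignVector) hc
  have hl (hd : d₁ e ≠ d₂ e) : 1 ≤ |d₂ e - d₁ e| :=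
    (r₂.right.isSignVector hf₂.isSignVector).one_le_abs_sub
      (r₁.right.isSignVector hf₁.isSignVector) hd.symm
  by_cases hc : c₁ e = c₂ e <;> by_cases hd : d₁ e = d₂ e
  · simp only [hc, hd, sub_self, mul_zero, add_zero]
    by_cases hv0 : v e = 0
    · exact Or.inr ⟨by rw [hv0, zero_mul], (absurd hv0 ·)⟩
    by_cases hw0 : w e = 0
    · exact Or.inr ⟨by rw [hw0, mul_zero], hmem hw0⟩
    exact Or.inl ((hvm hv0).mul_pos (r₁.eq_of_sub_eq_zero r₂ hf₁ hf₂ ht hc hd) (hwm hw0) hf₁)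
  · rw [hc, sub_self, mul_zero, add_zero]
    by_cases hv0 : v e = 0
    · exact Or.inr ⟨by rw [hv0, zero_mul], (absurd hv0 ·)⟩
    exact Or.inl <| mul_add_two_mul_pos
      (r₁.mul_sub_pos_of_misses r₂ hf₁ hf₂ ht hc hd (hvm hv0)) hw (hl hd)
  · rw [hd, sub_self, mul_zero, add_zero, mul_comm]
    by_cases hw0 : w e = 0
    · exact Or.inr ⟨by rw [hw0, zero_mul], hmem hw0⟩
    have := r₁.dual.mul_sub_pos_of_misses (B₁ := B₁ᶜ) (B₂ := B₂ᶜ) (v := -w) r₂.dual hf₁ hf₂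
      (fun ho => by rw [r₁.tileSet_compl, r₂.tileSet_compl]; exact not_congr (ht ho)) hd hc
      (by simpa only [compl_compl] using hwm hw0)
    rw [Pi.neg_apply, neg_mul_comm, neg_sub] at this
    exact Or.inl (mul_add_two_mul_pos this hv (hk hc))
  · have hkl := r₁.sub_eq_sub_of_ne r₂ hf₁ hf₂ ht hc hd
    have := mul_add_two_mul_pos (mul_self_pos.2 (sub_ne_zero.2 hc)) hw (hk hc)
    rw [mul_comm] at this
    rw [mul_comm, ← hkl]
    exact Or.inl (mul_add_two_mul_pos this hv (hk hc))

-- The orthogonal vectors `C + 2(c₁ - c₂)` and `w + 2(d₂ - d₁)` would have a nonnegative product at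
-- every edge, so each of these products would vanish and the support of `C` would lie in `B₁`.
theorem RegularPair.not_tile [Fintype E] (h : RegularPair N V W) {C : E → ℝ}
    (hB₁ : N.Indep B₁) (hf₁ : IsOrient f₁) (hf₂ : IsOrient f₂) (hC : SignedCircuitIn N V C)
    (hCm : ∀ e, C e ≠ 0 → Misses B₁ᶜ f₁ B₂ᶜ f₂ C e)
    (hmiss : ∀ v, SignedCircuitIn N V v → ∃ e, Misses B₁ f₁ B₂ f₂ v e)
    (r₁ : ReversesTo V W f₁ c₁ d₁ o₁) (r₂ : ReversesTo V W f₂ c₂ d₂ o₂)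
    (ht : ∀ e, o₁ e ≠ o₂ e → (e ∈ tileSet B₁ c₁ d₁ ↔ e ∈ tileSet B₂ c₂ d₂)) : False := by
  obtain ⟨w, hw, hw1, hwm, hw0⟩ := h.exists_separating hf₁ hf₂ hmiss
  have key (e) := r₁.mul_pos_or_mem r₂ hf₁ hf₂ (ht e) hC.sign.abs_le_one (hCm e) (hw1 e)
    (hwm e) (hw0 e)
  have hV : C + (2 : ℝ) • (c₁ - c₂) ∈ V :=
    V.add_mem hC.mem (V.smul_mem _ (V.sub_mem r₁.mem_left r₂.mem_left))
  have hW : w + (2 : ℝ) • (d₂ - d₁) ∈ W :=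
    W.add_mem hw (W.smul_mem _ (W.sub_mem r₂.mem_right r₁.mem_right))
  have hsum := h.dotProduct_eq_zero hV hW
  replace hsum := (Finset.sum_eq_zero_iff_of_nonneg fun e _ =>
    (key e).elim le_of_lt fun he => he.1.ge).1 hsum
  refine hC.ne_zero ((h.left.indep_iff B₁).1 hB₁ C hC.mem fun e he => ?_)
  exact (((key e).resolve_left fun hpos => hpos.ne' (hsum e (Finset.mem_univ e))).2 he).1

theorem ReversesTo.eq_of_notMem (r₁ : ReversesTo V W f c₁ d₁ o₁) (r₂ : ReversesTo V W f c₂ d₂ o₂)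
    (ht : o₁ e ≠ o₂ e → (e ∈ tileSet B c₁ d₁ ↔ e ∈ tileSet B c₂ d₂)) (he : e ∉ B)
    (h : c₁ e = c₂ e ∨ d₁ e = d₂ e) : c₁ e = c₂ e := by
  refine h.elim id fun hd => ?_
  simp only [mem_tileSet] at ht
  have := r₁.cases e
  have := r₂.cases e
  grind

theorem RegularPair.eq_of_tile [Fintype E] (h : RegularPair N V W) (hB : N.IsBase B)
    (hf : IsOrient f) (r₁ : ReversesTo V W f c₁ d₁ o₁) (r₂ : ReversesTo V W f c₂ d₂ o₂)
    (ht : ∀ e, o₁ e ≠ o₂ e → (e ∈ tileSet B c₁ d₁ ↔ e ∈ tileSet B c₂ d₂)) :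
    c₁ = c₂ ∧ d₁ = d₂ := by
  have hc := V.sub_mem r₁.mem_left r₂.mem_left
  have hd := W.sub_mem r₂.mem_right r₁.mem_right
  have hor (e) : c₁ e = c₂ e ∨ d₁ e = d₂ e := by
    have hnonneg (e) : 0 ≤ (c₁ - c₂) e * (d₂ - d₁) e := by
      by_contra! hlt
      have := r₁.sub_eq_sub_of_ne r₂ hf hf (ht e) (fun hc => by simp [hc] at hlt)
        fun hd => by simp [hd] at hlt
      simp only [Pi.sub_apply, ← this] at hlt
      exact (mul_self_nonneg _).not_gt hlt
    have := (Finset.sum_eq_zero_iff_of_nonneg fun e _ => hnonneg e).1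
      (h.dotProduct_eq_zero hc hd) e (Finset.mem_univ e)
    exact (mul_eq_zero.1 this).imp sub_eq_zero.1 fun h => (sub_eq_zero.1 h).symm
  have hcc : c₁ = c₂ := sub_eq_zero.1 <| (h.left.indep_iff B).1 hB.indep _ hc fun e he => by
    by_contra heB
    exact he (sub_eq_zero.2 (r₁.eq_of_notMem r₂ (ht e) heB (hor e)))
  have hdd : d₂ = d₁ := sub_eq_zero.1 <|
    (h.right.indep_iff Bᶜ).1 (h.left.indep_compl hB) _ hd fun e he heB => by
      refine he (sub_eq_zero.2 (r₁.dual.eq_of_notMem (B := Bᶜ) r₂.dual (fun ho => ?_)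
        (not_not.2 heB) (hor e).symm).symm)
      rw [r₁.tileSet_compl, r₂.tileSet_compl]
      exact not_congr (ht e ho)
  exact ⟨hcc, hdd.symm⟩

end Tiling

open Relation (EqvGen)

section Representatives

variable {E : Type*} {N : Matroid E} {V W : Submodule ℝ (E → ℝ)} {f c d o o' : E → ℝ}

theorem ReversesTo.refl (V W : Submodule ℝ (E → ℝ)) (o : E → ℝ) : ReversesTo V W o 0 0 o where
  mem_left := V.zero_mem
  mem_right := W.zero_mem
  left _ he := absurd rfl he
  right _ he := absurd rfl he
  disjoint _ := Or.inl rfl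
  eq := by simp

theorem ReversesTo.right_only (r : ReversesTo V W f c d o) :
    ReversesTo V W f 0 d (f - (2 : ℝ) • d) where
  mem_left := V.zero_mem
  mem_right := r.mem_right
  left _ he := absurd rfl he
  right := r.right
  disjoint _ := Or.inl rfl
  eq := by simp

theorem eqvGen_step_of_circuitStep (hs : EqvGen (CircuitStep N V) o o') :
    EqvGen (Step N V W) o o' :=
  EqvGen.mono (fun _ _ => Or.inl) _ _ hs

theorem sub_mem_of_eqvGen_circuitStep (hs : EqvGen (CircuitStep N V) o o') : o - o' ∈ V :=
  sub_mem_of_eqvGen (H := V.toAddSubgroup) (fun _ _ h => h.sub_mem_evenVectors.1) hs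

theorem ReversesTo.indep_tileSet_iff {B : Set E} (r : ReversesTo V W f c d o)
    (h : UnimodularSpace N V) (hB : N.Indep B) : N.Indep (tileSet B c d) ↔ c = 0 := by
  refine ⟨fun hi => (h.indep_iff _).1 hi c r.mem_left fun e he => ?_, ?_⟩
  · exact mem_tileSet.2 ⟨Or.inr he, (r.disjoint e).resolve_left he⟩
  · rintro rfl
    exact hB.subset fun e he => (mem_tileSet.1 he).1.resolve_right (· rfl)

variable [Fintype E]

theorem ReversesTo.eqvGen_circuitStep (r : ReversesTo V W f c d o) (h : RegularPair N V W)
    (hf : IsOrient f) : EqvGen (CircuitStep N V) (f - (2 : ℝ) • d) o := by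
  have hco : ContainedIn c (f - (2 : ℝ) • d) := fun e he => by
    simp [(r.disjoint e).resolve_left he, r.left e he]
  have := h.left.eqvGen_circuitStep r.mem_left (r.left.isSignVector hf.isSignVector) hco
  rwa [sub_sub, ← smul_add, add_comm d, ← r.eq] at this

theorem ReversesTo.eqvGen (r : ReversesTo V W f c d o) (h : RegularPair N V W) (hf : IsOrient f) :
    EqvGen (Step N V W) f o := by
  have hd := r.right_only.dual.eqvGen_circuitStep h.dual hf
  rw [smul_zero, sub_zero] at hd
  have hc := r.eqvGen_circuitStep h hf
  have hd' : EqvGen (Step N V W) f (f - (2 : ℝ) • d) := step_dual ▸ eqvGen_step_of_circuitStep hd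
  exact hd'.trans _ _ _ (eqvGen_step_of_circuitStep hc)

theorem RegularPair.existsUnique_representative (h : RegularPair N V W) {ι : Type*}
    {F : ι → E → ℝ} (hF : ∀ i, IsOrient (F i))
    (hex : ∀ o, IsOrient o → ∃ i c d, ReversesTo V W (F i) c d o)
    (hne : ∀ i j, EqvGen (Step N V W) (F i) (F j) → i = j) (ho : IsOrient o) :
    ∃! o', EqvGen (CircuitStep N V) o o' ∧ ∃ i d, ReversesTo V W (F i) 0 d o' := by
  obtain ⟨i, c, d, r⟩ := hex o ho
  have hs := r.eqvGen_circuitStep h (hF i)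
  refine ⟨F i - (2 : ℝ) • d, ⟨hs.symm, i, d, r.right_only⟩, ?_⟩
  rintro o' ⟨hs', j, d', r'⟩
  obtain rfl : i = j := hne i j <| (r.eqvGen h (hF i)).trans _ _ _ <|
    (eqvGen_step_of_circuitStep hs').trans _ _ _ <| (r'.eqvGen h (hF j)).symm
  have hV := sub_mem_of_eqvGen_circuitStep (hs.trans _ _ _ hs')
  have hW : F i - (2 : ℝ) • d - o' ∈ W := by
    rw [r'.eq, zero_add, sub_sub_sub_cancel_left, ← smul_sub]
    exact W.smul_mem _ (W.sub_mem r'.mem_right r.mem_right)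
  exact (sub_eq_zero.1 (dotProduct_self_eq_zero.1 (h.dotProduct_eq_zero hV hW))).symm

theorem ReversesTo.spanning_tileSet_iff {B : Set E} (r : ReversesTo V W f c d o)
    (h : RegularPair N V W) (hB : N.IsBase B) : N.Spanning (tileSet B c d) ↔ d = 0 := by
  rw [← r.dual.indep_tileSet_iff h.right (h.left.indep_compl hB), r.tileSet_compl,
    Matroid.spanning_iff_compl_coindep (by simp [h.left.ground]), Matroid.coindep_def,
    h.left.ground, ← Set.compl_eq_univ_sdiff]

end Representatives

section TilingFamily

variable {E : Type*} {N : Matroid E} {V W : Submodule ℝ (E → ℝ)} {f : Base N → E → ℝ}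
  {B B' : Base N} {c c' d d' o o' : E → ℝ} {S S' : Set E}

/-- A family of orientations, one for each basis, such that the half-open cells attached to
different bases do not overlap. -/
structure IsTilingFamily (V W : Submodule ℝ (E → ℝ)) (f : Base N → E → ℝ) : Prop where
  isOrient (B : Base N) : IsOrient (f B)
  eq_of_tile {B B' : Base N} {c c' d d' o o' : E → ℝ} (r : ReversesTo V W (f B) c d o)
    (r' : ReversesTo V W (f B') c' d' o')
    (ht : ∀ e, o e ≠ o' e → (e ∈ tileSet B.1 c d ↔ e ∈ tileSet B'.1 c' d')) : B = B'

/-- The vector form of `IsExtendedValue`: `S` is the set assigned to the orientation `o`. -/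
def IsTileOf (V W : Submodule ℝ (E → ℝ)) (f : Base N → E → ℝ) (o : E → ℝ) (S : Set E) : Prop :=
  ∃ (B : Base N) (c d : E → ℝ), ReversesTo V W (f B) c d o ∧ S = tileSet B.1 c d

variable [Fintype E]

theorem IsTilingFamily.eq_of_eqvGen (hf : IsTilingFamily V W f) (h : RegularPair N V W)
    (hs : EqvGen (Step N V W) (f B) (f B')) : B = B' := by
  obtain ⟨c, d, r⟩ := h.exists_reversesTo (hf.isOrient B) hs
  exact hf.eq_of_tile r (ReversesTo.refl V W _) fun _ hne => absurd rfl hne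

theorem IsTilingFamily.existsUnique_eqvGen (hf : IsTilingFamily V W f) (h : RegularPair N V W)
    (ho : IsOrient o) : ∃! B, EqvGen (Step N V W) (f B) o := by
  obtain ⟨B, hB⟩ := h.exists_eqvGen_of_inequivalent hf.isOrient (fun _ _ => hf.eq_of_eqvGen h) ho
  exact ⟨B, hB, fun B' hB' => hf.eq_of_eqvGen h (hB'.trans _ _ _ hB.symm)⟩

theorem IsTilingFamily.exists_reversesTo (hf : IsTilingFamily V W f) (h : RegularPair N V W)
    (ho : IsOrient o) : ∃ B c d, ReversesTo V W (f B) c d o := by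
  obtain ⟨B, hB, -⟩ := hf.existsUnique_eqvGen h ho
  exact ⟨B, h.exists_reversesTo (hf.isOrient B) hB⟩

theorem IsTilingFamily.eq_and_eq_of_tile (hf : IsTilingFamily V W f) (h : RegularPair N V W)
    (hS : IsTileOf V W f o S) (hS' : IsTileOf V W f o' S')
    (ht : ∀ e, o e ≠ o' e → (e ∈ S ↔ e ∈ S')) : o = o' ∧ S = S' := by
  obtain ⟨B, c, d, r, rfl⟩ := hS
  obtain ⟨B', c', d', r', rfl⟩ := hS'
  obtain rfl := hf.eq_of_tile r r' ht
  obtain ⟨rfl, rfl⟩ := h.eq_of_tile B.2 (hf.isOrient B) r r' ht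
  exact ⟨r.eq.trans r'.eq.symm, rfl⟩

theorem IsTilingFamily.existsUnique_isTileOf (hf : IsTilingFamily V W f) (h : RegularPair N V W)
    (ho : IsOrient o) : ∃! S, IsTileOf V W f o S := by
  obtain ⟨B, c, d, r⟩ := hf.exists_reversesTo h ho
  refine ⟨tileSet B.1 c d, ⟨B, c, d, r, rfl⟩, fun S hS => ?_⟩
  exact (hf.eq_and_eq_of_tile h hS ⟨B, c, d, r, rfl⟩ fun _ hne => absurd rfl hne).2

theorem IsTileOf.indep_iff (hS : IsTileOf V W f o S) (hf : IsTilingFamily V W f)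
    (h : RegularPair N V W) : N.Indep S ↔ ∃ B d, ReversesTo V W (f B) 0 d o := by
  constructor
  · intro hi
    obtain ⟨B, c, d, r, rfl⟩ := hS
    obtain rfl := (r.indep_tileSet_iff h.left B.2.indep).1 hi
    exact ⟨B, d, r⟩
  · rintro ⟨B, d, r⟩
    obtain rfl := (hf.eq_and_eq_of_tile h hS ⟨B, 0, d, r, rfl⟩ fun _ hne => absurd rfl hne).2
    exact (r.indep_tileSet_iff h.left B.2.indep).2 rfl

theorem IsTileOf.spanning_iff (hS : IsTileOf V W f o S) (hf : IsTilingFamily V W f)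
    (h : RegularPair N V W) : N.Spanning S ↔ ∃ B c, ReversesTo W V (f B) 0 c o := by
  constructor
  · intro hs
    obtain ⟨B, c, d, r, rfl⟩ := hS
    obtain rfl := (r.spanning_tileSet_iff h B.2).1 hs
    exact ⟨B, c, r.dual⟩
  · rintro ⟨B, c, r⟩
    have r' := r.dual
    obtain rfl := (hf.eq_and_eq_of_tile h hS ⟨B, c, 0, r', rfl⟩ fun _ hne => absurd rfl hne).2
    exact (r'.spanning_tileSet_iff h B.2).2 rfl

end TilingFamily

section Orientations

variable {E : Type*} {c o v w : E → ℝ}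

theorem signCast_injective : Function.Injective fun s : ℤˣ => ((s : ℤ) : ℝ) :=
  Int.cast_injective.comp Units.val_injective

theorem signCast_ne_zero (s : ℤˣ) : ((s : ℤ) : ℝ) ≠ 0 :=
  Int.cast_ne_zero.2 s.ne_zero

theorem exists_signCast_eq {x : ℝ} (hx : x = 1 ∨ x = -1) : ∃ s : ℤˣ, ((s : ℤ) : ℝ) = x := by
  rcases hx with rfl | rfl
  exacts [⟨1, by simp⟩, ⟨-1, by simp⟩]

theorem mem_arcs {e : E} {s : ℤˣ} : (e, s) ∈ arcs v ↔ v e = ((s : ℤ) : ℝ) := Iff.rfl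

theorem IsSignVector.arcs_subset_arcs_iff (hv : IsSignVector v) :
    arcs v ⊆ arcs o ↔ ContainedIn v o := by
  refine ⟨fun h e he => ?_, fun h ⟨e, s⟩ hs => ?_⟩
  · obtain ⟨s, hs⟩ := exists_signCast_eq ((hv e).resolve_left he)
    exact hs.symm.trans (mem_arcs.1 (h (mem_arcs.2 hs.symm))).symm
  · have hve := mem_arcs.1 hs
    exact mem_arcs.2 ((h e (hve ▸ signCast_ne_zero s)).symm.trans hve)

theorem IsSignVector.eq_of_arcs_eq (hv : IsSignVector v) (hw : IsSignVector w)
    (h : arcs v = arcs w) : v = w := by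
  funext e
  by_cases he : v e = 0
  · by_contra hne
    exact hne (hw.arcs_subset_arcs_iff.1 h.ge e fun h0 => hne (he.trans h0.symm)).symm
  · exact hv.arcs_subset_arcs_iff.1 h.le e he

theorem rev_rev (F : Fourientation E) : rev (rev F) = F := by
  ext ⟨e, s⟩
  simp [rev]

theorem arcs_neg (v : E → ℝ) : arcs (-v) = rev (arcs v) := by
  ext ⟨e, s⟩
  simp [arcs, rev, neg_eq_iff_eq_neg]

theorem arcs_subset_rev_iff {F : Fourientation E} : arcs v ⊆ rev F ↔ arcs (-v) ⊆ F := by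
  rw [arcs_neg]
  exact ⟨fun h => rev_rev F ▸ Set.preimage_mono h, fun h => rev_rev (arcs v) ▸ Set.preimage_mono h⟩

theorem ContainedIn.arcs_reverse (hco : ContainedIn c o) :
    (arcs o \ arcs c) ∪ arcs (-c) = arcs (o - (2 : ℝ) • c) := by
  ext ⟨e, s⟩
  simp only [Set.mem_union, Set.mem_sdiff, mem_arcs, Pi.neg_apply, Pi.sub_apply, Pi.smul_apply,
    smul_eq_mul]
  by_cases he : c e = 0
  · simp [he, (signCast_ne_zero s).symm]
  · rw [hco e he, two_mul, sub_add_cancel_left]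
    simp

theorem iUnion_arcs {𝒮 : Set (E → ℝ)} (h𝒮 : ∀ v ∈ 𝒮, ContainedIn v o) (hco : ContainedIn c o)
    (hunion : ⋃ v ∈ 𝒮, Function.support v = Function.support c) : ⋃ v ∈ 𝒮, arcs v = arcs c := by
  ext ⟨e, s⟩
  simp only [Set.mem_iUnion, mem_arcs, exists_prop]
  constructor
  · rintro ⟨v, hv, hve⟩
    have hve0 : v e ≠ 0 := hve ▸ signCast_ne_zero s
    have hce0 : e ∈ Function.support c := hunion ▸ Set.mem_biUnion hv hve0
    rw [hco e hce0, ← h𝒮 v hv e hve0, hve]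
  · intro hce
    have hce0 : c e ≠ 0 := hce ▸ signCast_ne_zero s
    obtain ⟨v, hv, hve0⟩ := Set.mem_iUnion₂.1 (hunion.ge hce0)
    exact ⟨v, hv, by rw [h𝒮 v hv e hve0, ← hco e hce0, hce]⟩

theorem iUnion_arcs_neg {𝒮 : Set (E → ℝ)} (h𝒮 : ⋃ v ∈ 𝒮, arcs v = arcs c) :
    ⋃ v ∈ 𝒮, arcs (-v) = arcs (-c) := by
  simp only [arcs_neg, ← h𝒮]
  exact Set.preimage_iUnion₂.symm

/-- The `±1`-vector of an orientation: it takes the value `s` on `e` when the arc `(e, s)` belongs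
to `O`. -/
noncomputable def Orientation.sign (O : Orientation E) (e : E) : ℝ :=
  (((O.2 e).exists.choose : ℤˣ) : ℤ)

theorem Orientation.arcs_sign (O : Orientation E) : arcs O.sign = O.1 := by
  ext ⟨e, s⟩
  have hs := (O.2 e).exists.choose_spec
  refine ⟨fun h => ?_, fun h => ?_⟩
  · exact signCast_injective (mem_arcs.1 h) ▸ hs
  · exact mem_arcs.2 (congrArg (fun t : ℤˣ => ((t : ℤ) : ℝ)) ((O.2 e).unique hs h))

theorem Orientation.isOrient_sign (O : Orientation E) : IsOrient O.sign := fun e => by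
  rw [Orientation.sign]
  rcases Int.units_eq_one_or (O.2 e).exists.choose with h | h <;> simp [h]

theorem Orientation.sign_injective : Function.Injective (Orientation.sign (E := E)) :=
  fun O O' h => Subtype.ext (by rw [← O.arcs_sign, h, O'.arcs_sign])

theorem range_sign : Set.range (Orientation.sign (E := E)) = {o | IsOrient o} := by
  refine Set.Subset.antisymm (Set.range_subset_iff.2 Orientation.isOrient_sign) fun o ho => ?_
  have hone (e : E) : OneWay (arcs o) e := by
    obtain ⟨s, hs⟩ := exists_signCast_eq (ho e)
    exact ⟨s, hs.symm, fun t ht => signCast_injective ((mem_arcs.1 ht).symm.trans hs.symm)⟩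
  exact ⟨⟨arcs o, hone⟩, (Orientation.isOrient_sign _).isSignVector.eq_of_arcs_eq
    (IsOrient.isSignVector ho) (Orientation.arcs_sign _)⟩

theorem Orientation.coe_eq_arcs_iff (O : Orientation E) (ho : IsOrient o) :
    O.1 = arcs o ↔ O.sign = o := by
  rw [← O.arcs_sign]
  exact ⟨O.isOrient_sign.isSignVector.eq_of_arcs_eq ho.isSignVector, congrArg arcs⟩

theorem Orientation.coe_eq_reversal_iff (O O' : Orientation E) {𝒮 : Set (E → ℝ)}
    (h𝒮 : ∀ v ∈ 𝒮, ContainedIn v O.sign) (hco : ContainedIn c O.sign)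
    (hunion : ⋃ v ∈ 𝒮, Function.support v = Function.support c) :
    O'.1 = (O.1 \ ⋃ v ∈ 𝒮, arcs v) ∪ ⋃ v ∈ 𝒮, arcs (-v) ↔ O'.sign = O.sign - (2 : ℝ) • c := by
  have harcs := iUnion_arcs h𝒮 hco hunion
  rw [harcs, iUnion_arcs_neg harcs, ← O.arcs_sign, hco.arcs_reverse,
    O'.coe_eq_arcs_iff (O.isOrient_sign.sub_two_smul hco)]

theorem sign_eq_of_restrict_eq {O O' : Orientation E} {e : E}
    (h : restrict O.1 e = restrict O'.1 e) : O.sign e = O'.sign e := by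
  obtain ⟨s, hs⟩ := exists_signCast_eq (O.isOrient_sign e)
  have hmem : (e, s) ∈ restrict O.1 e := ⟨O.arcs_sign ▸ hs.symm, rfl⟩
  have hmem' : (e, s) ∈ arcs O'.sign := O'.arcs_sign ▸ (h.le hmem).1
  exact hs.symm.trans (mem_arcs.1 hmem').symm

theorem eqvGen_comp_iff {α β : Type*} {g : α → β} (hg : Function.Injective g) {R : β → β → Prop}
    (hR : ∀ x y, R x y → (x ∈ Set.range g ↔ y ∈ Set.range g)) (a b : α) :
    Relation.EqvGen (fun a b => R (g a) (g b)) a b ↔ Relation.EqvGen R (g a) (g b) := by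
  suffices h : ∀ x y, Relation.EqvGen R x y → (x ∈ Set.range g ↔ y ∈ Set.range g) ∧
      ∀ a b, g a = x → g b = y → Relation.EqvGen (fun a b => R (g a) (g b)) a b by
    refine ⟨fun hab => ?_, fun hab => (h _ _ hab).2 a b rfl rfl⟩
    induction hab with
    | rel _ _ h => exact .rel _ _ h
    | refl => exact .refl _
    | symm _ _ _ ih => exact ih.symm
    | trans _ _ _ _ _ ih ih' => exact ih.trans _ _ _ ih'
  intro x y hxy
  induction hxy with
  | rel x y h => exact ⟨hR x y h, by rintro a b rfl rfl; exact .rel _ _ h⟩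
  | refl x => exact ⟨Iff.rfl, by rintro a b rfl hb; exact hg hb ▸ .refl _⟩
  | symm x y _ ih => exact ⟨ih.1.symm, fun a b ha hb => (ih.2 b a hb ha).symm⟩
  | trans x y z _ _ ih ih' =>
    refine ⟨ih.1.trans ih'.1, fun a b ha hb => ?_⟩
    obtain ⟨a', rfl⟩ := ih.1.1 ⟨a, ha⟩
    exact (ih.2 a a' ha rfl).trans _ _ _ (ih'.2 a' b rfl hb)

theorem eqvGen_sign_iff {R : (E → ℝ) → (E → ℝ) → Prop}
    (hR : ∀ o o', R o o' → (IsOrient o ↔ IsOrient o')) (O O' : Orientation E) :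
    Relation.EqvGen (fun O O' : Orientation E => R O.sign O'.sign) O O' ↔
      Relation.EqvGen R O.sign O'.sign :=
  eqvGen_comp_iff Orientation.sign_injective (fun x y h => range_sign ▸ hR x y h) O O'

theorem existsUnique_orientation {P : (E → ℝ) → Prop} (hP : ∃! o, P o)
    (hor : ∀ o, P o → IsOrient o) : ∃! O : Orientation E, P O.sign := by
  obtain ⟨o, ho, huniq⟩ := hP
  obtain ⟨O, rfl⟩ := range_sign.ge (hor o ho)
  exact ⟨O, ho, fun O' hO' => Orientation.sign_injective (huniq _ hO')⟩

theorem exists_injective_orientation (E : Type*) :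
    ∃ g : Set E → Orientation E, Function.Injective g := by
  have hone (S : Set E) (e : E) : OneWay {a | a.2 = 1 ↔ a.1 ∈ S} e := by
    by_cases he : e ∈ S
    · exact ⟨1, by simp [he], fun t ht => ht.2 he⟩
    · exact ⟨-1, by simp [he], fun t ht => (Int.units_eq_one_or t).resolve_left (he ∘ ht.1)⟩
  refine ⟨fun S => ⟨_, hone S⟩, fun S S' h => Set.ext fun e => ?_⟩
  have hiff : (e, (1 : ℤˣ)) ∈ {a : Arc E | a.2 = 1 ↔ a.1 ∈ S} ↔
      (e, (1 : ℤˣ)) ∈ {a : Arc E | a.2 = 1 ↔ a.1 ∈ S'} := Set.ext_iff.1 (congrArg Subtype.val h) _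
  simpa using hiff

theorem Tiling.bijective [Finite E] {φ : Orientation E → Set E} (hφ : Tiling φ) :
    Function.Bijective φ := by
  have hinj : Function.Injective φ := fun O O' h => by
    by_contra hne
    obtain ⟨e, -, he⟩ := hφ O O' hne
    simp [h] at he
  obtain ⟨g, hg⟩ := exists_injective_orientation E
  exact ⟨hinj, (Finite.injective_iff_surjective.1 (hinj.comp hg)).of_comp⟩

end Orientations

section Translation

open LinearMap (ker range)

variable {E m : Type*} {N : Matroid E} {V : Submodule ℝ (E → ℝ)} {c d o : E → ℝ}

theorem ContainedIn.add (hc : ContainedIn c o) (hd : ContainedIn d o)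
    (hcd : ∀ e, c e = 0 ∨ d e = 0) : ContainedIn (c + d) o := fun e he => by
  rcases hcd e with h | h <;> simp only [Pi.add_apply, h, zero_add, add_zero] at he ⊢
  exacts [hd e he, hc e he]

theorem support_add_of_disjoint (hcd : ∀ e, c e = 0 ∨ d e = 0) :
    Function.support (c + d) = Function.support c ∪ Function.support d := by
  ext e
  rcases hcd e with h | h <;> simp [h]

theorem exists_mem_of_pairwiseDisjoint {𝒞 : Set (E → ℝ)} (hfin : 𝒞.Finite)
    (h𝒞 : ∀ v ∈ 𝒞, v ∈ V ∧ ContainedIn v o) (hd : 𝒞.PairwiseDisjoint Function.support) :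
    ∃ c ∈ V, ContainedIn c o ∧ ⋃ v ∈ 𝒞, Function.support v = Function.support c := by
  induction 𝒞, hfin using Set.Finite.induction_on with
  | empty => exact ⟨0, V.zero_mem, fun e he => absurd rfl he, by simp⟩
  | @insert u 𝒞 hu _ ih =>
    obtain ⟨⟨huV, huo⟩, h𝒞'⟩ := Set.forall_mem_insert.1 h𝒞
    obtain ⟨c, hc, hco, hunion⟩ := ih h𝒞' (hd.subset (Set.subset_insert u 𝒞))
    have hdisj : Disjoint (Function.support u) (Function.support c) := by
      rw [← hunion, Set.disjoint_iUnion₂_right]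
      exact fun v hv => hd (Set.mem_insert u 𝒞) (Set.mem_insert_of_mem u hv)
        (ne_of_mem_of_not_mem hv hu).symm
    have huc (e : E) : u e = 0 ∨ c e = 0 := by
      by_contra! h
      exact hdisj.notMem_of_mem_left h.1 h.2
    refine ⟨u + c, V.add_mem huV hc, huo.add hco huc, ?_⟩
    rw [Set.biUnion_insert, hunion, support_add_of_disjoint huc]

theorem isSignedCircuit_iff [Fintype E] {M : Matrix m E ℝ} {v : E → ℝ} :
    IsSignedCircuit M N v ↔ SignedCircuitIn N (ker M.mulVecLin) v :=
  ⟨fun h => ⟨h.1, h.2.1, h.2.2⟩, fun h => ⟨h.1, h.2, h.3⟩⟩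

theorem isSignedCocircuit_iff [Fintype m] {M : Matrix m E ℝ} {v : E → ℝ} :
    IsSignedCocircuit M N v ↔ SignedCircuitIn N✶ (range Mᵀ.mulVecLin) v :=
  ⟨fun h => ⟨h.1, h.2.1, h.2.2⟩, fun h => ⟨h.1, h.2, h.3⟩⟩

theorem circuitStep_sign_iff (O O' : Orientation E) :
    CircuitStep N V O.sign O'.sign ↔
      ∃ v, SignedCircuitIn N V v ∧ arcs v ⊆ O.1 ∧ O'.1 = (O.1 \ arcs v) ∪ arcs (-v) := by
  refine exists_congr fun v => and_congr_right fun hv => ?_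
  rw [← O.arcs_sign, hv.sign.arcs_subset_arcs_iff, O.arcs_sign]
  refine and_congr_right fun hvo => ?_
  simpa using (O.coe_eq_reversal_iff O' (𝒮 := {v}) (by simpa using hvo) hvo (by simp)).symm

theorem circuitReversal_iff [Fintype E] (M : Matrix m E ℝ) (O O' : Orientation E) :
    CircuitReversal M N O O' ↔ CircuitStep N (ker M.mulVecLin) O.sign O'.sign := by
  simp only [CircuitReversal, isSignedCircuit_iff, circuitStep_sign_iff]

theorem cocircuitReversal_iff [Fintype m] (M : Matrix m E ℝ) (O O' : Orientation E) :
    CocircuitReversal M N O O' ↔ CircuitStep N✶ (range Mᵀ.mulVecLin) O.sign O'.sign := by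
  simp only [CocircuitReversal, isSignedCocircuit_iff, circuitStep_sign_iff]

theorem sameCircuitClass_iff [Fintype E] (M : Matrix m E ℝ) (O O' : Orientation E) :
    SameCircuitClass M N O O' ↔
      Relation.EqvGen (CircuitStep N (ker M.mulVecLin)) O.sign O'.sign := by
  rw [← eqvGen_sign_iff fun _ _ h => ⟨h.isOrient, h.symm.isOrient⟩]
  simp only [SameCircuitClass, ← circuitReversal_iff]

theorem sameCocircuitClass_iff [Fintype m] (M : Matrix m E ℝ) (O O' : Orientation E) :
    SameCocircuitClass M N O O' ↔
      Relation.EqvGen (CircuitStep N✶ (range Mᵀ.mulVecLin)) O.sign O'.sign := by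
  rw [← eqvGen_sign_iff fun _ _ h => ⟨h.isOrient, h.symm.isOrient⟩]
  simp only [SameCocircuitClass, ← cocircuitReversal_iff]

variable [Fintype E] [Fintype m]

theorem sameCircuitCocircuitClass_iff (M : Matrix m E ℝ) (O O' : Orientation E) :
    SameCircuitCocircuitClass M N O O' ↔
      Relation.EqvGen (Step N (ker M.mulVecLin) (range Mᵀ.mulVecLin)) O.sign O'.sign := by
  rw [← eqvGen_sign_iff fun _ _ h => isOrient_iff_of_eqvGen (.rel _ _ h)]
  simp only [SameCircuitCocircuitClass, Step, ← circuitReversal_iff, ← cocircuitReversal_iff]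

variable {M : Matrix m E ℝ} {O O' : Orientation E} {𝒞 𝒟 : Set (E → ℝ)}

theorem DifferBy.exists_reversesTo (h : DifferBy M N O O' 𝒞 𝒟) :
    ∃ c d, ReversesTo (ker M.mulVecLin) (range Mᵀ.mulVecLin) O.sign c d O'.sign ∧
      ⋃ v ∈ 𝒞, Function.support v = Function.support c ∧
      ⋃ v ∈ 𝒟, Function.support v = Function.support d := by
  have h𝒞 (v) (hv : v ∈ 𝒞) : v ∈ ker M.mulVecLin ∧ ContainedIn v O.sign :=
    ⟨(h.circuit v hv).1.2.1, (h.circuit v hv).1.1.arcs_subset_arcs_iff.1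
      (O.arcs_sign ▸ (h.circuit v hv).2)⟩
  have h𝒟 (v) (hv : v ∈ 𝒟) : v ∈ range Mᵀ.mulVecLin ∧ ContainedIn v O.sign :=
    ⟨(h.cocircuit v hv).1.2.1, (h.cocircuit v hv).1.1.arcs_subset_arcs_iff.1
      (O.arcs_sign ▸ (h.cocircuit v hv).2)⟩
  obtain ⟨c, hc, hco, hcs⟩ := exists_mem_of_pairwiseDisjoint
    (finite_isSignVector.subset fun v hv => (h.circuit v hv).1.1) h𝒞 h.disjoint_circuits
  obtain ⟨d, hd, hdo, hds⟩ := exists_mem_of_pairwiseDisjoint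
    (finite_isSignVector.subset fun v hv => (h.cocircuit v hv).1.1) h𝒟 h.disjoint_cocircuits
  have hcd (e : E) : c e = 0 ∨ d e = 0 := by
    by_contra! hne
    obtain ⟨v, hv, hve⟩ := Set.mem_iUnion₂.1 (hcs.ge hne.1)
    obtain ⟨w, hw, hwe⟩ := Set.mem_iUnion₂.1 (hds.ge hne.2)
    exact (h.disjoint_circuit_cocircuit v hv w hw).notMem_of_mem_left hve hwe
  refine ⟨c, d, ⟨hc, hd, hco, hdo, hcd, ?_⟩, hcs, hds⟩
  refine (O.coe_eq_reversal_iff O' (fun v hv => hv.elim (fun h => (h𝒞 v h).2) fun h => (h𝒟 v h).2)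
    (hco.add hdo hcd) ?_).1 h.eq
  rw [Set.biUnion_union, hcs, hds, support_add_of_disjoint hcd]

theorem ReversesTo.exists_differBy
    (r : ReversesTo (ker M.mulVecLin) (range Mᵀ.mulVecLin) O.sign c d O'.sign)
    (h : RegularPair N (ker M.mulVecLin) (range Mᵀ.mulVecLin)) :
    ∃ 𝒞 𝒟, DifferBy M N O O' 𝒞 𝒟 ∧ ⋃ v ∈ 𝒞, Function.support v = Function.support c ∧
      ⋃ v ∈ 𝒟, Function.support v = Function.support d := by
  have hO := O.isOrient_sign.isSignVector
  obtain ⟨𝒞, h𝒞, h𝒞d, hcs⟩ :=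
    h.left.exists_disjoint_circuits r.mem_left (r.left.isSignVector hO)
  obtain ⟨𝒟, h𝒟, h𝒟d, hds⟩ :=
    h.right.exists_disjoint_circuits r.mem_right (r.right.isSignVector hO)
  have h𝒞o (v) (hv : v ∈ 𝒞) : ContainedIn v O.sign := (h𝒞 v hv).2.trans r.left
  have h𝒟o (v) (hv : v ∈ 𝒟) : ContainedIn v O.sign := (h𝒟 v hv).2.trans r.right
  refine ⟨𝒞, 𝒟, ⟨fun v hv => ⟨isSignedCircuit_iff.2 (h𝒞 v hv).1, ?_⟩,
    fun v hv => ⟨isSignedCocircuit_iff.2 (h𝒟 v hv).1, ?_⟩, h𝒞d, h𝒟d, fun v hv w hw => ?_, ?_⟩,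
    hcs, hds⟩
  · exact O.arcs_sign ▸ (h𝒞 v hv).1.sign.arcs_subset_arcs_iff.2 (h𝒞o v hv)
  · exact O.arcs_sign ▸ (h𝒟 v hv).1.sign.arcs_subset_arcs_iff.2 (h𝒟o v hv)
  · refine Set.disjoint_left.2 fun e hve hwe => (r.disjoint e).elim ?_ ?_
    · exact hcs.le (Set.mem_biUnion hv hve)
    · exact hds.le (Set.mem_biUnion hw hwe)
  · refine (O.coe_eq_reversal_iff O' (fun v hv => hv.elim (h𝒞o v) (h𝒟o v))
      (r.left.add r.right r.disjoint) ?_).2 r.eq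
    rw [Set.biUnion_union, hcs, hds, support_add_of_disjoint r.disjoint]

theorem isExtendedValue_iff (h : RegularPair N (ker M.mulVecLin) (range Mᵀ.mulVecLin))
    (A : ExternalAtlas N) (A' : InternalAtlas N) (S : Set E) :
    IsExtendedValue M A A' O S ↔ IsTileOf (ker M.mulVecLin) (range Mᵀ.mulVecLin)
      (fun B => (basisMap A A' B).sign) O.sign S := by
  refine exists_congr fun B => ⟨?_, ?_⟩
  · rintro ⟨𝒞, 𝒟, -, hD, rfl⟩
    obtain ⟨c, d, r, hcs, hds⟩ := hD.exists_reversesTo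
    exact ⟨c, d, r, by rw [hcs, hds, tileSet]⟩
  · rintro ⟨c, d, r, rfl⟩
    obtain ⟨𝒞, 𝒟, hD, hcs, hds⟩ := r.exists_differBy h
    refine ⟨𝒞, 𝒟, ?_, hD, by rw [hcs, hds, tileSet]⟩
    exact (sameCircuitCocircuitClass_iff M _ _).2 (r.eqvGen h (basisMap A A' B).isOrient_sign)

end Translation

section Atlases

open LinearMap (ker range)

variable {E m : Type*} {N : Matroid E} {X₁ X₂ : Set E} {f₁ f₂ v : E → ℝ} {e : E}

/-- The fourientation in which the edges in `X` are bioriented and the other edges are oriented as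
in the `±1`-vector `f`. -/
def biorient (X : Set E) (f : E → ℝ) : Fourientation E := Prod.fst ⁻¹' X ∪ arcs f

theorem ExternalAtlas.fou_eq_biorient (A : ExternalAtlas N) (A' : InternalAtlas N) (B : Base N) :
    A.fou B = biorient B.1 (basisMap A A' B).sign := by
  rw [biorient, Orientation.arcs_sign]
  ext ⟨e, s⟩
  by_cases he : e ∈ B.1
  · simp [he, A.internal B e he s]
  · simp [he, basisMap, A'.external B e he s]

theorem InternalAtlas.fou_eq_biorient (A : ExternalAtlas N) (A' : InternalAtlas N) (B : Base N) :
    A'.fou B = biorient B.1ᶜ (basisMap A A' B).sign := by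
  rw [biorient, Orientation.arcs_sign]
  ext ⟨e, s⟩
  by_cases he : e ∈ B.1
  · simp [he, basisMap, A.internal B e he s]
  · simp [he, A'.external B e he s]

theorem notMem_biorient_iff {X : Set E} {f : E → ℝ} (hf : IsOrient f) (s : ℤˣ) :
    (e, s) ∉ biorient X f ↔ e ∉ X ∧ f e * ((s : ℤ) : ℝ) < 0 := by
  rw [biorient, Set.mem_union, not_or, Set.mem_preimage, mem_arcs]
  refine and_congr_right fun _ => ?_
  rcases hf e with h | h <;> rcases Int.units_eq_one_or s with rfl | rfl <;> norm_num [h]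

theorem notMem_inter_rev_iff_misses (hf₁ : IsOrient f₁) (hf₂ : IsOrient f₂) {s : ℤˣ}
    (hs : (e, s) ∈ arcs v) :
    (e, s) ∉ biorient X₁ f₁ ∩ rev (biorient X₂ f₂) ↔ Misses X₁ f₁ X₂ f₂ v e := by
  have hrev : (e, s) ∉ rev (biorient X₂ f₂) ↔ e ∉ X₂ ∧ 0 < f₂ e * v e := by
    rw [mem_arcs.1 hs]
    change (e, -s) ∉ biorient X₂ f₂ ↔ _
    simpa using notMem_biorient_iff (X := X₂) (e := e) hf₂ (-s)
  rw [Set.mem_inter_iff, not_and_or, hrev, notMem_biorient_iff hf₁, Misses, mem_arcs.1 hs]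

theorem exists_misses_of_not_arcs_subset (hf₁ : IsOrient f₁) (hf₂ : IsOrient f₂)
    (h : ¬ arcs v ⊆ biorient X₁ f₁ ∩ rev (biorient X₂ f₂)) : ∃ e, Misses X₁ f₁ X₂ f₂ v e := by
  obtain ⟨⟨e, s⟩, hs, hmem⟩ := Set.not_subset.1 h
  exact ⟨e, (notMem_inter_rev_iff_misses hf₁ hf₂ hs).1 hmem⟩

theorem IsSignVector.misses_of_arcs_subset_compl (hv : IsSignVector v) (hf₁ : IsOrient f₁)
    (hf₂ : IsOrient f₂) (h : arcs v ⊆ (biorient X₁ f₁ ∩ rev (biorient X₂ f₂))ᶜ) (he : v e ≠ 0) :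
    Misses X₁ f₁ X₂ f₂ v e := by
  obtain ⟨s, hs⟩ := exists_signCast_eq ((hv e).resolve_left he)
  have hmem : (e, s) ∈ arcs v := hs.symm
  exact (notMem_inter_rev_iff_misses hf₁ hf₂ hmem).1 (h hmem)

variable {A : ExternalAtlas N} {A' : InternalAtlas N} {M : Matrix m E ℝ} {B₁ B₂ : Base N}

theorem ExternalAtlas.Dissecting.exists_misses [Fintype m] (hA : A.Dissecting M)
    (A' : InternalAtlas N) (hne : B₁ ≠ B₂) :
    ∃ D, SignedCircuitIn N✶ (range Mᵀ.mulVecLin) D ∧ ∀ e, D e ≠ 0 →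
      Misses B₁.1 (basisMap A A' B₁).sign B₂.1 (basisMap A A' B₂).sign D e := by
  obtain ⟨v, hv, hsub⟩ := hA B₁ B₂ hne
  rw [arcs_subset_rev_iff, A.fou_eq_biorient A', A.fou_eq_biorient A'] at hsub
  have hv' := (isSignedCocircuit_iff.1 hv).neg
  exact ⟨-v, hv', fun e => hv'.sign.misses_of_arcs_subset_compl
    (Orientation.isOrient_sign _) (Orientation.isOrient_sign _) hsub⟩

theorem InternalAtlas.Dissecting.exists_misses [Fintype E] (hA' : A'.Dissecting M)
    (A : ExternalAtlas N) (hne : B₁ ≠ B₂) :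
    ∃ C, SignedCircuitIn N (ker M.mulVecLin) C ∧ ∀ e, C e ≠ 0 →
      Misses B₁.1ᶜ (basisMap A A' B₁).sign B₂.1ᶜ (basisMap A A' B₂).sign C e := by
  obtain ⟨v, hv, hsub⟩ := hA' B₁ B₂ hne
  rw [A'.fou_eq_biorient A, A'.fou_eq_biorient A] at hsub
  exact ⟨v, isSignedCircuit_iff.1 hv, fun e => hv.1.misses_of_arcs_subset_compl
    (Orientation.isOrient_sign _) (Orientation.isOrient_sign _) hsub⟩

theorem ExternalAtlas.Triangulating.exists_misses [Fintype E] (hA : A.Triangulating M)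
    (A' : InternalAtlas N) (hne : B₁ ≠ B₂) (hv : SignedCircuitIn N (ker M.mulVecLin) v) :
    ∃ e, Misses B₁.1 (basisMap A A' B₁).sign B₂.1 (basisMap A A' B₂).sign v e := by
  refine exists_misses_of_not_arcs_subset (Orientation.isOrient_sign _)
    (Orientation.isOrient_sign _) fun hsub => hA B₁ B₂ hne ⟨v, isSignedCircuit_iff.2 hv, ?_⟩
  rwa [A.fou_eq_biorient A', A.fou_eq_biorient A']

theorem InternalAtlas.Triangulating.exists_misses [Fintype m] (hA' : A'.Triangulating M)
    (A : ExternalAtlas N) (hne : B₁ ≠ B₂) (hv : SignedCircuitIn N✶ (range Mᵀ.mulVecLin) v) :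
    ∃ e, Misses B₁.1ᶜ (basisMap A A' B₁).sign B₂.1ᶜ (basisMap A A' B₂).sign v e := by
  refine exists_misses_of_not_arcs_subset (Orientation.isOrient_sign _)
    (Orientation.isOrient_sign _) fun hsub =>
      hA' B₁ B₂ hne ⟨-v, isSignedCocircuit_iff.2 hv.neg, ?_⟩
  rwa [arcs_subset_rev_iff, neg_neg, compl_compl, A'.fou_eq_biorient A, A'.fou_eq_biorient A]

variable [Fintype E] [Fintype m]

theorem isTilingFamily_basisMap (h : RegularPair N (ker M.mulVecLin) (range Mᵀ.mulVecLin))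
    (hA : A.Dissecting M) (hA' : A'.Dissecting M) (hT : A.Triangulating M ∨ A'.Triangulating M) :
    IsTilingFamily (ker M.mulVecLin) (range Mᵀ.mulVecLin)
      fun B => (basisMap A A' B).sign where
  isOrient B := (basisMap A A' B).isOrient_sign
  eq_of_tile {B₁ B₂ c₁ c₂ d₁ d₂ o₁ o₂} r₁ r₂ ht := by
    by_contra hne
    have hf (B : Base N) := (basisMap A A' B).isOrient_sign
    rcases hT with hT | hT
    · obtain ⟨C, hC, hCm⟩ := hA'.exists_misses A hne
      exact h.not_tile B₁.2.indep (hf B₁) (hf B₂) hC hCm (fun v => hT.exists_misses A' hne) r₁ r₂ ht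
    · obtain ⟨D, hD, hDm⟩ := hA.exists_misses A' hne
      refine h.dual.not_tile (B₁ := B₁.1ᶜ) (B₂ := B₂.1ᶜ) (h.left.indep_compl B₁.2) (hf B₁) (hf B₂)
        hD ?_ (fun v => hT.exists_misses A hne) r₁.dual r₂.dual fun e he => ?_
      · rwa [compl_compl, compl_compl]
      · rw [r₁.tileSet_compl, r₂.tileSet_compl]
        exact not_congr (ht e he)

end Atlases

section Extension

open LinearMap (ker range)

variable {E m : Type*} [Fintype E] {N : Matroid E} {V W : Submodule ℝ (E → ℝ)}
  {f : Base N → E → ℝ} {M : Matrix m E ℝ}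

theorem IsTilingFamily.tiling (hf : IsTilingFamily V W f) (h : RegularPair N V W)
    {φ : Orientation E → Set E} (hφ : ∀ O, IsTileOf V W f O.sign (φ O)) : Tiling φ := by
  intro O O' hne
  by_contra! hno
  refine hne (Orientation.sign_injective (hf.eq_and_eq_of_tile h (hφ O) (hφ O') fun e he => ?_).1)
  have := hno e (mt sign_eq_of_restrict_eq he)
  rw [Set.mem_symmDiff] at this
  tauto

theorem IsTilingFamily.isRepresentativeSet_indep
    (hf : IsTilingFamily (ker M.mulVecLin) W f) (h : RegularPair N (ker M.mulVecLin) W)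
    {φ : Orientation E ≃ Set E} (hφ : ∀ O, IsTileOf (ker M.mulVecLin) W f O.sign (φ O)) :
    IsRepresentativeSet (SameCircuitClass M N) (φ.symm '' {S | N.Indep S}) := by
  intro O
  simp only [Equiv.image_symm_eq_preimage, Set.mem_preimage, Set.mem_ofPred_eq,
    (hφ _).indep_iff hf h, sameCircuitClass_iff, and_comm]
  exact existsUnique_orientation (h.existsUnique_representative hf.isOrient
    (fun _ ho => hf.exists_reversesTo h ho) (fun _ _ => hf.eq_of_eqvGen h) O.isOrient_sign)
    fun o ho => (isOrient_iff_of_eqvGen (W := W) (eqvGen_step_of_circuitStep ho.1)).1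
      O.isOrient_sign

theorem IsTilingFamily.isRepresentativeSet_spanning [Fintype m]
    (hf : IsTilingFamily V (range Mᵀ.mulVecLin) f) (h : RegularPair N V (range Mᵀ.mulVecLin))
    {φ : Orientation E ≃ Set E} (hφ : ∀ O, IsTileOf V (range Mᵀ.mulVecLin) f O.sign (φ O)) :
    IsRepresentativeSet (SameCocircuitClass M N) (φ.symm '' {S | N.Spanning S}) := by
  intro O
  simp only [Equiv.image_symm_eq_preimage, Set.mem_preimage, Set.mem_ofPred_eq,
    (hφ _).spanning_iff hf h, sameCocircuitClass_iff, and_comm]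
  refine existsUnique_orientation (h.dual.existsUnique_representative hf.isOrient
    (fun o ho => ?_) (fun B B' hs => hf.eq_of_eqvGen h (step_dual ▸ hs)) O.isOrient_sign)
    fun o ho => (isOrient_iff_of_eqvGen (W := V) (eqvGen_step_of_circuitStep ho.1)).1
      O.isOrient_sign
  obtain ⟨B, c, d, r⟩ := hf.exists_reversesTo h ho
  exact ⟨B, d, c, r.dual⟩

end Extension

end RegularMatroid

open RegularMatroid in
theorem theorem1p8 {E m : Type*} [Fintype E] [Fintype m]
    (M : Matrix m E ℝ) (N : Matroid E)
    (hM : M.IsTotallyUnimodular) (hMN : RegularMatroid.Represents M N)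
    (A : RegularMatroid.ExternalAtlas N) (A' : RegularMatroid.InternalAtlas N)
    (hA : A.Dissecting M) (hA' : A'.Dissecting M)
    (hT : A.Triangulating M ∨ A'.Triangulating M) :
    (∀ O : RegularMatroid.Orientation E, ∃! B : RegularMatroid.Base N,
      RegularMatroid.SameCircuitCocircuitClass M N (RegularMatroid.basisMap A A' B) O) ∧
    ∃ φ : RegularMatroid.Orientation E ≃ Set E,
      (∀ (O : RegularMatroid.Orientation E) (S : Set E),
        RegularMatroid.IsExtendedValue M A A' O S ↔ S = φ O) ∧
      RegularMatroid.Tiling φ ∧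
      RegularMatroid.IsRepresentativeSet (RegularMatroid.SameCircuitClass M N)
        (φ.symm '' {S | N.Indep S}) ∧
      RegularMatroid.IsRepresentativeSet (RegularMatroid.SameCocircuitClass M N)
        (φ.symm '' {S | N.Spanning S}) := by
  have h := regularPair_ker_range hM hMN
  have hf := isTilingFamily_basisMap h hA hA' hT
  refine ⟨fun O => ?_, ?_⟩
  · simpa only [sameCircuitCocircuitClass_iff] using hf.existsUnique_eqvGen h O.isOrient_sign
  choose φ hφ hφ_unique using fun O : Orientation E =>
    hf.existsUnique_isTileOf h O.isOrient_sign
  have hφ_tiling : Tiling φ := hf.tiling h hφ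
  refine ⟨Equiv.ofBijective φ hφ_tiling.bijective, fun O S => ?_, hφ_tiling,
    hf.isRepresentativeSet_indep h hφ, hf.isRepresentativeSet_spanning h hφ⟩
  rw [isExtendedValue_iff h]
  exact ⟨hφ_unique O S, fun hS => hS ▸ hφ O⟩
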